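/- Let $k$ be a field, let $n\ge 1$ and $p\ge 0$ be integers, let $R=k[x_0,\dots,x_n]$ with its standard grading, and let $Z\subset\mathbb{P}^n=\operatorname{Proj}R$ be a closed subscheme with ideal sheaf $\mathscr{I}_Z$ and saturated homogeneous ideal $I_Z=\bigoplus_m H^0(\mathscr{I}_Z(m))\subset R$. Let $V^*=\langle dx_0,\dots,dx_n\rangle$, let $\Omega_R^q=R\otimes_k\bigwedge^qV^*$ be the module of polynomial differential $q$-forms, and let $\iota_{\mathrm{rad}}\colon\Omega_R^{q+1}\to\Omega_R^{q}$ be the contraction with the radial vector field $\mathrm{rad}=\sum_i x_i\,\partial/\partial x_i$. Let $$\mathcal{A}^p(Z)=\bigoplus_{d\in\mathbb{Z}}H^0\bigl(\mathbb{P}^n,\Omega^p_{\mathbb{P}^n}(d+p+1)\otimes\mathscr{I}_Z\bigr)$$ be the graded $R$-module of twisted differential $p$-forms vanishing on $Z$; if $p\ge1$, its components of degree $d<0$ are zero. Let $I_Z\cdot\iota_{\mathrm{rad}}\Omega_R^{p+1}\subset\Omega_R^p$ be the image of $I_Z\otimes_R\iota_{\mathrm{rad}}\Omega_R^{p+1}$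 under multiplication, graded so that its component of degree $d$ is $(I_Z)_d\cdot\iota_{\mathrm{rad}}\bigwedge^{p+1}V^*$. Let $\operatorname{Tor}_p^R(I_Z,k)$, where $k=R/(x_0,\dots,x_n)$, carry its natural grading, which may be computed from any graded free resolution of $I_Z$ (and such a resolution exists). Then there is an exact sequence of graded $R$-modules $$0\longrightarrow I_Z\cdot\iota_{\mathrm{rad}}\Omega_R^{p+1}\longrightarrow\mathcal{A}^p(Z)\longrightarrow\operatorname{Tor}_p^R(I_Z,k)(p+1)\longrightarrow0,$$ in which the first map sends a polynomial form to the section of $\bigoplus_d\Omega^p_{\mathbb{P}^n}(d+p+1)\otimes\mathscr{I}_Z$ that it defines. Moreover, if $(I_Z)_d=0$ for an integer $d$, then the second map restricts to an isomorphism $\mathcal{A}^p(Z)_d\cong\operatorname{Tor}_p^R(I_Z,k)_{d+p+1}$. -/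

import Mathlib

universe u

open CategoryTheory AlgebraicGeometry

noncomputable section

namespace SyzForms

/-! ### Differential forms: pullback and interior product -/

section Forms

variable {k A B : Type*} [CommRing k] [CommRing A] [CommRing B] [Algebra k A] [Algebra k B]

variable (k A) in
/-- The `A`-module `Ω^p_{A/k}` of Kähler `p`-forms of a `k`-algebra `A`. -/
def Forms (p : ℕ) : Type _ := ⋀[A]^p (Ω[A⁄k])

instance (p : ℕ) : AddCommGroup (Forms k A p) := inferInstanceAs (AddCommGroup (⋀[A]^p (Ω[A⁄k])))

instance (p : ℕ) : Module A (Forms k A p) := inferInstanceAs (Module A (⋀[A]^p (Ω[A⁄k])))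

instance (p : ℕ) : Module k (Forms k A p) := Module.compHom _ (algebraMap k A)

instance (p : ℕ) : IsScalarTower k A (Forms k A p) :=
  ⟨fun c a ω => by
    change (c • a) • ω = algebraMap k A c • a • ω
    rw [Algebra.smul_def, mul_smul]⟩

/-- The form `da₁ ∧ ⋯ ∧ da_p`. -/
def wedgeD (k : Type*) {A : Type*} [CommRing k] [CommRing A] [Algebra k A] {p : ℕ}
    (a : Fin p → A) : Forms k A p :=
  exteriorPower.ιMulti A p fun j => KaehlerDifferential.D k A (a j)

/-- Pullback of `p`-forms along a homomorphism `φ : A → B` of `k`-algebras: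
`a · da₁ ∧ ⋯ ∧ da_p ↦ φ(a) · d(φ(a₁)) ∧ ⋯ ∧ d(φ(a_p))`. -/
def pullback (φ : A →ₐ[k] B) (p : ℕ) : Forms k A p →ₛₗ[(φ : A →+* B)] Forms k B p :=
  letI : Algebra A B := (φ : A →+* B).toAlgebra
  haveI : IsScalarTower k A B := .of_algebraMap_eq' φ.comp_algebraMap.symm
  let g : (⋀[A]^p (Ω[A⁄k])) →ₗ[A] (⋀[B]^p (Ω[B⁄k])) :=
    exteriorPower.alternatingMapLinearEquiv
      { toMultilinearMap :=
          ((exteriorPower.ιMulti B p (M := Ω[B⁄k])).toMultilinearMap.restrictScalars A).compLinearMap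
            fun _ => KaehlerDifferential.map k k A B
        map_eq_zero_of_eq' := fun _ _ _ h hij =>
          (exteriorPower.ιMulti B p (M := Ω[B⁄k])).map_eq_zero_of_eq _
            (congrArg (KaehlerDifferential.map k k A B) h) hij }
  { toFun := g
    map_add' := g.map_add
    map_smul' := fun a x => by
      have h := (g.map_smul a x).trans (algebraMap_smul B a (g x)).symm
      exact h }

theorem pullback_wedgeD (φ : A →ₐ[k] B) {p : ℕ} (a : Fin p → A) :
    pullback φ p (wedgeD k a) = wedgeD k fun j => φ (a j) := by
  let : Algebra A B := (φ : A →+* B).toAlgebra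
  have : IsScalarTower k A B := .of_algebraMap_eq' φ.comp_algebraMap.symm
  refine (exteriorPower.alternatingMapLinearEquiv_apply_ιMulti (N := ⋀[B]^p (Ω[B⁄k])) _ _).trans ?_
  change exteriorPower.ιMulti B p
    (fun j => KaehlerDifferential.map k k A B (KaehlerDifferential.D k A (a j))) = _
  simp only [KaehlerDifferential.map_D]
  rfl

theorem pullback_smul_base (φ : A →ₐ[k] B) (p : ℕ) (c : k) (ω : Forms k A p) :
    pullback φ p (c • ω) = c • pullback φ p ω := by
  rw [← algebraMap_smul A c ω, ← algebraMap_smul B c, ← φ.commutes c]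
  exact (pullback φ p).map_smulₛₗ _ _

end Forms

section Contraction

variable {A M : Type*} [CommRing A] [AddCommGroup M] [Module A M]

theorem contractLeft_mem (e : M →ₗ[A] A) :
    ∀ (p : ℕ) (x : ExteriorAlgebra A M), x ∈ ⋀[A]^(p + 1) M →
      CliffordAlgebra.contractLeft (Q := (0 : QuadraticForm A M)) e x ∈ ⋀[A]^p M := by
  intro p
  induction p with
  | zero =>
    intro x hx
    change x ∈ LinearMap.range (ExteriorAlgebra.ι A) ^ (0 + 1) at hx
    change _ ∈ LinearMap.range (ExteriorAlgebra.ι A) ^ 0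
    rw [zero_add, pow_one] at hx
    obtain ⟨m, rfl⟩ := hx
    rw [pow_zero]
    exact Submodule.mem_one.2 ⟨e m, (CliffordAlgebra.contractLeft_ι 0 e m).symm⟩
  | succ p ih =>
    intro x hx
    change x ∈ LinearMap.range (ExteriorAlgebra.ι A) ^ (p + 1 + 1) at hx
    change _ ∈ LinearMap.range (ExteriorAlgebra.ι A) ^ (p + 1)
    rw [pow_succ'] at hx
    refine Submodule.mul_induction_on hx ?_ ?_
    · rintro _ ⟨m, rfl⟩ y hy
      have h := CliffordAlgebra.contractLeft_ι_mul (Q := (0 : QuadraticForm A M)) e m y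
      change CliffordAlgebra.contractLeft (Q := (0 : QuadraticForm A M)) e
        (CliffordAlgebra.ι 0 m * y) ∈ _
      rw [h]
      refine Submodule.sub_mem _ (Submodule.smul_mem _ _ hy) ?_
      rw [pow_succ']
      exact Submodule.mul_mem_mul ⟨m, rfl⟩ (ih y hy)
    · intro x y hx hy
      rw [map_add]
      exact Submodule.add_mem _ hx hy

/-- Interior product with a linear functional `e` on `M`:
`m₀ ∧ ⋯ ∧ m_p ↦ ∑ⱼ (-1)ʲ e(mⱼ) m₀ ∧ ⋯ ∧ m̂ⱼ ∧ ⋯ ∧ m_p`. -/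
def contract (e : M →ₗ[A] A) (p : ℕ) : (⋀[A]^(p + 1) M) →ₗ[A] (⋀[A]^p M) :=
  (CliffordAlgebra.contractLeft (Q := (0 : QuadraticForm A M)) e).restrict (contractLeft_mem e p)

end Contraction

/-! ### Projective space and its standard charts -/

section Projective

variable (k : Type u) [Field k] (n : ℕ)

/-- `R = k[x₀, …, xₙ]`. -/
abbrev Poly : Type u := MvPolynomial (Fin (n + 1)) k

/-- The grading of `R` by degree. -/
abbrev grading : ℕ → Submodule k (Poly k n) := MvPolynomial.homogeneousSubmodule (Fin (n + 1)) k

/-- The degree `d` part of `R`, for an integer `d` (it is `0` if `d < 0`). -/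
def polyDegree (d : ℤ) : Submodule k (Poly k n) :=
  if 0 ≤ d then grading k n d.toNat else ⊥

instance : GradedAlgebra (grading k n) := MvPolynomial.gradedAlgebra

/-- Projective space `ℙⁿ = Proj R`. -/
abbrev PSpace : Scheme.{u} := Proj (grading k n)

variable {k n}

/-- The coordinate `xᵢ`. -/
abbrev coord (i : Fin (n + 1)) : Poly k n := MvPolynomial.X i

variable (k) in
/-- The coordinate ring of the standard chart `D₊(xᵢ)` of `ℙⁿ`: the degree `0` part of the
localization `R_{xᵢ}`. -/
abbrev Chart (i : Fin (n + 1)) : Type u :=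
  HomogeneousLocalization.Away (grading k n) (coord i)

variable (k) in
/-- The coordinate ring `R_{xᵢ}` of the open set `{xᵢ ≠ 0}` of `𝔸ⁿ⁺¹ ∖ {0}`, the preimage of the
chart `D₊(xᵢ)`. -/
abbrev Cone (i : Fin (n + 1)) : Type u := Localization.Away (coord i : Poly k n)

variable (k) in
/-- The coordinate ring `R_{xᵢxⱼ}` of the open set `{xᵢxⱼ ≠ 0}` of `𝔸ⁿ⁺¹ ∖ {0}`. -/
abbrev Overlap (i j : Fin (n + 1)) : Type u :=
  Localization.Away (coord i * coord j : Poly k n)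

instance (i : Fin (n + 1)) : Algebra k (Chart k i) where
  algebraMap := (algebraMap (grading k n 0) (Chart k i)).comp (algebraMap k (grading k n 0))
  commutes' _ _ := mul_comm _ _
  smul_def' c x := by
    apply HomogeneousLocalization.val_injective
    rw [HomogeneousLocalization.val_smul, HomogeneousLocalization.val_mul, Algebra.smul_def]
    rfl

instance (i : Fin (n + 1)) : IsScalarTower k (Chart k i) (Cone k i) :=
  ⟨fun c x y => by
    change (c • x).val * y = c • (x.val * y)
    rw [HomogeneousLocalization.val_smul, smul_mul_assoc]⟩

/-- The inclusion of coordinate rings `(R_{xᵢ})₀ ⊆ R_{xᵢ}`, i.e. the projection of the open set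
`{xᵢ ≠ 0}` of `𝔸ⁿ⁺¹ ∖ {0}` onto the chart `D₊(xᵢ)`. -/
def chartToCone (i : Fin (n + 1)) : Chart k i →ₐ[k] Cone k i :=
  IsScalarTower.toAlgHom k (Chart k i) (Cone k i)

/-- The localization map `R → R_{xᵢ}`. -/
def polyToCone (i : Fin (n + 1)) : Poly k n →ₐ[k] Cone k i :=
  IsScalarTower.toAlgHom k (Poly k n) (Cone k i)

/-- The localization map `R_{xᵢ} → R_{xᵢxⱼ}`. -/
def coneToOverlapLeft (i j : Fin (n + 1)) : Cone k i →ₐ[k] Overlap k i j :=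
  IsLocalization.liftAlgHom (M := Submonoid.powers (coord i : Poly k n))
    (f := IsScalarTower.toAlgHom k (Poly k n) (Overlap k i j)) (by
      rintro ⟨_, m, rfl⟩
      have h := IsLocalization.Away.algebraMap_isUnit (S := Overlap k i j)
        (coord i * coord j : Poly k n)
      rw [map_mul] at h
      simpa using (isUnit_of_mul_isUnit_left h).pow m)

/-- The localization map `R_{xⱼ} → R_{xᵢxⱼ}`. -/
def coneToOverlapRight (i j : Fin (n + 1)) : Cone k j →ₐ[k] Overlap k i j :=
  IsLocalization.liftAlgHom (M := Submonoid.powers (coord j : Poly k n))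
    (f := IsScalarTower.toAlgHom k (Poly k n) (Overlap k i j)) (by
      rintro ⟨_, m, rfl⟩
      have h := IsLocalization.Away.algebraMap_isUnit (S := Overlap k i j)
        (coord i * coord j : Poly k n)
      rw [map_mul] at h
      simpa using (isUnit_of_mul_isUnit_right h).pow m)

/-- `xᵢ` as a unit of `R_{xᵢ}`. -/
def coordUnit (i : Fin (n + 1)) : (Cone k i)ˣ :=
  (IsLocalization.Away.algebraMap_isUnit (S := Cone k i) (coord i : Poly k n)).unit

instance (i : Fin (n + 1)) (p : ℕ) : Module (Poly k n) (Forms k (Cone k i) p) :=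
  Module.compHom _ (algebraMap (Poly k n) (Cone k i))

instance (i : Fin (n + 1)) (p : ℕ) : IsScalarTower k (Poly k n) (Forms k (Cone k i) p) :=
  ⟨fun c f ω => by
    change algebraMap (Poly k n) (Cone k i) (c • f) • ω =
      c • algebraMap (Poly k n) (Cone k i) f • ω
    rw [Algebra.smul_def, map_mul, mul_smul, MvPolynomial.algebraMap_eq,
      ← IsScalarTower.algebraMap_smul (Cone k i) c]
    rfl⟩

variable (k n) in
/-- Families of `p`-forms on the open sets `{xᵢ ≠ 0}` of `𝔸ⁿ⁺¹ ∖ {0}`. -/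
abbrev ConeForms (p : ℕ) : Type u := ∀ i : Fin (n + 1), Forms k (Cone k i) p

/-! ### Closed subschemes, their ideals, and forms vanishing on them -/

section Subscheme

variable {Z : Scheme.{u}} (ι : Z ⟶ PSpace k n)

/-- The sections over the chart `D₊(xᵢ)` of the ideal sheaf `𝓘_Z`, the kernel of
`𝒪_{ℙⁿ} → ι_* 𝒪_Z`, as an ideal of the coordinate ring of the chart. -/
def chartIdeal (i : Fin (n + 1)) : Ideal (Chart k i) :=
  RingHom.ker ((ι.app (Proj.basicOpen (grading k n) (coord i))).hom.comp
    (Proj.awayToSection (grading k n) (coord i)).hom)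

/-- The saturated homogeneous ideal `I_Z = ⨁ₘ H⁰(𝓘_Z(m)) ⊆ R`: a homogeneous polynomial `f` of
degree `m` is a section of `𝓘_Z(m)` if on each chart it is `xᵢᵐ` times a section of `𝓘_Z`. -/
def satIdeal : Ideal (Poly k n) :=
  Ideal.span {f | ∃ m : ℕ, f ∈ grading k n m ∧ ∀ i, ∃ a ∈ chartIdeal ι i,
    polyToCone i f = ((coordUnit i ^ m : (Cone k i)ˣ) : Cone k i) * chartToCone i a}

/-- The global sections `H⁰(ℙⁿ, Ω^p(r) ⊗ 𝓘_Z)`. On the chart `D₊(xᵢ)` a section of this sheaf is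
`xᵢʳ ⊗ η` for a `p`-form `η` of the chart which lies in `𝓘_Z · Ω^p = 𝓘_Z ⊗ Ω^p` (`Ω^p` is locally
free). Such a section is regarded as the `p`-form `xᵢʳ · η` on the open set `{xᵢ ≠ 0}` of the
punctured cone `𝔸ⁿ⁺¹ ∖ {0}` over `ℙⁿ`; as `R_{xᵢ}` is the ring of Laurent polynomials in `xᵢ` over
the coordinate ring of the chart, the pullback of forms from the chart to this open set is
injective. A global section is a family of sections on the charts which agree on the overlaps. -/
def twistedForms (p : ℕ) (r : ℤ) : Submodule k (ConeForms k n p) where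
  carrier := {ω |
    (∀ i, ∃ η ∈ chartIdeal ι i • (⊤ : Submodule (Chart k i) (Forms k (Chart k i) p)),
      ω i = ((coordUnit i ^ r : (Cone k i)ˣ) : Cone k i) • pullback (chartToCone i) p η) ∧
    ∀ i j, pullback (coneToOverlapLeft i j) p (ω i) = pullback (coneToOverlapRight i j) p (ω j)}
  zero_mem' := ⟨fun i => ⟨0, Submodule.zero_mem _, by
      rw [map_zero, smul_zero, Pi.zero_apply]⟩, fun i j => by
      rw [Pi.zero_apply, Pi.zero_apply, map_zero, map_zero]⟩
  add_mem' := by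
    rintro ω ω' ⟨h, hg⟩ ⟨h', hg'⟩
    refine ⟨fun i => ?_, fun i j => ?_⟩
    · obtain ⟨η, hη, e⟩ := h i
      obtain ⟨η', hη', e'⟩ := h' i
      refine ⟨η + η', Submodule.add_mem _ hη hη', ?_⟩
      rw [map_add, smul_add, Pi.add_apply, e, e']
    · rw [Pi.add_apply, Pi.add_apply, map_add, map_add, hg i j, hg' i j]
  smul_mem' := by
    rintro c ω ⟨h, hg⟩
    refine ⟨fun i => ?_, fun i j => ?_⟩
    · obtain ⟨η, hη, e⟩ := h i
      refine ⟨c • η, Submodule.smul_of_tower_mem _ c hη, ?_⟩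
      rw [Pi.smul_apply, e, pullback_smul_base, smul_comm]
    · rw [Pi.smul_apply, Pi.smul_apply, pullback_smul_base, pullback_smul_base, hg i j]

/-- The graded `R`-module `𝒜^p(Z) = ⨁_d H⁰(Ω^p(d+p+1) ⊗ 𝓘_Z)` of twisted `p`-forms vanishing
on `Z`. -/
def vanishingForms (p : ℕ) : Submodule (Poly k n) (ConeForms k n p) :=
  Submodule.span (Poly k n) (⋃ r : ℤ, (twistedForms ι p r : Set (ConeForms k n p)))

/-- The degree `d` part `H⁰(Ω^p(d+p+1) ⊗ 𝓘_Z)` of `𝒜^p(Z)`. -/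
def vanishingFormsDegree (p : ℕ) (d : ℤ) : Submodule k (vanishingForms ι p) :=
  (twistedForms ι p (d + p + 1)).comap ((vanishingForms ι p).subtype.restrictScalars k)

end Subscheme

/-! ### Polynomial forms and the radial vector field -/

section Radial

variable (k n) in
/-- Contraction of polynomial `1`-forms with the radial vector field `∑ xᵢ ∂/∂xᵢ`. -/
def radial : (Ω[Poly k n⁄k]) →ₗ[Poly k n] Poly k n :=
  (MvPolynomial.mkDerivation k fun i => (coord i : Poly k n)).liftKaehlerDifferential

variable (k n) in
/-- `ι_rad : Ω_R^{p+1} → Ω_R^p`. -/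
def iotaRad (p : ℕ) : Forms k (Poly k n) (p + 1) →ₗ[Poly k n] Forms k (Poly k n) p :=
  contract (radial k n) p

/-- The `R`-module `I · ι_rad Ω_R^{p+1} ⊆ Ω_R^p`, the image of `I ⊗ ι_rad Ω_R^{p+1}` in `Ω_R^p`. -/
def radialForms (I : Ideal (Poly k n)) (p : ℕ) : Submodule (Poly k n) (Forms k (Poly k n) p) :=
  I • LinearMap.range (iotaRad k n p)

/-- The degree `d` part `I_d · ι_rad (⋀^{p+1} V*)` of `I · ι_rad Ω_R^{p+1}`, where
`V* = ⟨dx₀, …, dxₙ⟩`. -/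
def radialFormsDegree (I : Ideal (Poly k n)) (p : ℕ) (d : ℤ) : Submodule k (radialForms I p) :=
  (Submodule.span k {ω | ∃ f ∈ I, f ∈ polyDegree k n d ∧ ∃ v : Fin (p + 1) → Fin (n + 1),
    ω = f • iotaRad k n p (wedgeD k fun j => coord (v j))}).comap
      ((radialForms I p).subtype.restrictScalars k)

/-- The restrictions of a polynomial `p`-form to the open sets `{xᵢ ≠ 0}`. -/
def restrictForm (p : ℕ) (ω : Forms k (Poly k n) p) : ConeForms k n p :=
  fun i => pullback (polyToCone i) p ω

end Radial

/-! ### Graded free resolutions and graded Tor -/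

/-- A graded free resolution `⋯ → F₁ → F₀ → I → 0` of a homogeneous ideal `I` of `R`: the graded
free module `F_p = ⨁_b R(-deg b)` has the homogeneous basis `gen p`. -/
structure GradedFreeResolution (I : Ideal (Poly k n)) where
  /-- the basis of `F_p` -/
  gen : ℕ → Type u
  /-- the degrees of the basis elements -/
  deg : ∀ p, gen p → ℤ
  /-- the differential `F_{p+1} → F_p` -/
  d : ∀ p, (gen (p + 1) →₀ Poly k n) →ₗ[Poly k n] (gen p →₀ Poly k n)
  /-- the augmentation `F₀ → I ⊆ R` -/
  aug : (gen 0 →₀ Poly k n) →ₗ[Poly k n] Poly k n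
  /-- the differentials are homogeneous of degree `0` -/
  d_homogeneous : ∀ p b c, d p (Finsupp.single b 1) c ∈ polyDegree k n (deg (p + 1) b - deg p c)
  /-- the augmentation is homogeneous of degree `0` -/
  aug_homogeneous : ∀ b, aug (Finsupp.single b 1) ∈ polyDegree k n (deg 0 b)
  /-- the augmentation maps onto `I` -/
  range_aug : LinearMap.range aug = I
  /-- exactness at `F₀` -/
  exact_zero : Function.Exact (d 0) aug
  /-- exactness at `F_{p+1}` -/
  exact_succ : ∀ p, Function.Exact (d (p + 1)) (d p)

namespace GradedFreeResolution

variable {I : Ideal (Poly k n)} (F : GradedFreeResolution I)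

/-- `F_p ⊗_R k = ⨁_b k(-deg b)`, where `k = R/(x₀, …, xₙ)`. -/
def Fiber (p : ℕ) : Type u := F.gen p →₀ k

instance (p : ℕ) : AddCommGroup (F.Fiber p) := inferInstanceAs (AddCommGroup (F.gen p →₀ k))

instance (p : ℕ) : Module k (F.Fiber p) := inferInstanceAs (Module k (F.gen p →₀ k))

/-- The differential of `F ⊗_R k`: its matrix consists of the constant coefficients of the entries
of the matrix of the differential of `F`. -/
def dBar (p : ℕ) : F.Fiber (p + 1) →ₗ[k] F.Fiber p :=
  Finsupp.linearCombination k fun b =>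
    (F.d p (Finsupp.single b 1)).mapRange MvPolynomial.constantCoeff (map_zero _)

/-- The `p`-cycles of the complex `⋯ → F₁ ⊗_R k → F₀ ⊗_R k → 0`. -/
def cycles : (p : ℕ) → Submodule k (F.Fiber p)
  | 0 => ⊤
  | p + 1 => LinearMap.ker (F.dBar p)

/-- The `p`-boundaries of the complex `⋯ → F₁ ⊗_R k → F₀ ⊗_R k → 0`, inside the `p`-cycles. -/
def boundaries (p : ℕ) : Submodule k (F.cycles p) :=
  (LinearMap.range (F.dBar p)).submoduleOf (F.cycles p)

/-- `Tor_p^R(I, k)`, the homology of `F ⊗_R k`. -/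
def Tor (p : ℕ) : Type u := F.cycles p ⧸ F.boundaries p

instance (p : ℕ) : AddCommGroup (F.Tor p) :=
  inferInstanceAs (AddCommGroup (F.cycles p ⧸ F.boundaries p))

instance (p : ℕ) : Module k (F.Tor p) :=
  inferInstanceAs (Module k (F.cycles p ⧸ F.boundaries p))

/-- `R` acts on `Tor_p^R(I, k)` through `R → k`. -/
instance (p : ℕ) : Module (Poly k n) (F.Tor p) :=
  Module.compHom (F.Tor p) (MvPolynomial.constantCoeff : Poly k n →+* k)

/-- `Tor_p^R(I, k)_m`: the classes of the cycles which are combinations of basis elements of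
degree `m`. -/
def torDegree (p : ℕ) (m : ℤ) : Submodule k (F.Tor p) :=
  (Submodule.comap (F.cycles p).subtype (Finsupp.supported k k {b | F.deg p b = m})).map
    (F.boundaries p).mkQ

end GradedFreeResolution

end Projective

end SyzForms

end

/-!
# Twisted differential forms vanishing on a closed subscheme, and `Tor`

Write `R = k[x₀, …, xₙ]`, let `V*` be the span of the `dxᵢ`, and let `I` be the saturated ideal of
`Z ⊂ ℙⁿ`. Both ends of the exact sequence come from the Koszul complex `I ⊗ ⋀ V*`, whose
differential is the contraction with the radial vector field: `𝒜^p(Z)` is its module of `p`-cycles,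
`I · ι_rad Ω^{p+1}` is its module of boundaries, and `Tor_p(I, k)` is its homology.

*Vanishing forms are cycles.* A `p`-form pulled back from a chart `D₊(xᵢ)` to `{xᵢ ≠ 0}` is killed
by the contraction with the radial vector field, and its coefficients with respect to the `dx_l` are
`xᵢ^{-p}` times functions on the chart. Hence the coefficients of a section of `Ω^p(r) ⊗ 𝓘_Z` are
functions of degree `r - p`; as `n ≥ 1` and `R` is factorial, they extend to polynomials, which lie
in `I` and form a Koszul cycle. Conversely, let `ω` be a polynomial form with coefficients of
degree `m` in `I` which is killed by the contraction, let `ψ` be the dehomogenization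
`x_l ↦ x_l / xᵢ`, and put `θ = dxᵢ`. From `dx_l = xᵢ d(x_l / xᵢ) + (x_l / xᵢ) θ` one gets
`θ ∧ ω = xᵢ^{m+p} θ ∧ ψ^* ω`. Both `ω` and `ψ^* ω` are killed by the contraction, so contracting
this identity and cancelling `xᵢ` gives `ω = xᵢ^{m+p} ψ^* ω` (`restrictForm_eq`). So `ω` comes from the
chart, where its coefficients are in `𝓘_Z`. This is `mem_twistedForms_iff`.

*Koszul homology is `Tor`.* Given a graded free resolution `F` of `I`, the double complex
`F ⊗ ⋀ V*` has exact rows and columns up to `I ⊗ ⋀ V*` at one edge and `F ⊗ k` at the other. An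
element of the homology at one edge is carried to the other one by a zigzag through the double
complex. The zigzags from the `p`-cycles of `I ⊗ ⋀ V*` to the `p`-cycles of `F ⊗ k` form a relation
which descends to a surjection of the cycles onto `Tor_p(I, k)`, with the Koszul boundaries as its
kernel (`GradedFreeResolution.exists_cycles_to_tor`). It adds `p` to the degree of the coefficients,
which is one more than the degree in `𝒜^p(Z)`.

Koszul forms with values in an `R`-module `M` are encoded as alternating maps on `k^{n+1}` with
values in `M`, which avoids choosing bases of the exterior powers.

The last claim holds because a Koszul boundary of coefficient degree `d + 1` is the image of a form
with coefficients in `I_d`.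
-/

noncomputable section

namespace SyzForms

/-! ### The Koszul complex with values in a module -/

section Alternating

variable {k : Type*} [CommRing k] {V M N : Type*} [AddCommGroup V] [Module k V]
  [AddCommGroup M] [Module k M] [AddCommGroup N] [Module k N]

theorem alternatingMap_sum_apply {ι κ : Type*} (s : Finset κ) (f : κ → V [⋀^ι]→ₗ[k] M)
    (v : ι → V) : (∑ i ∈ s, f i) v = ∑ i ∈ s, f i v := by
  classical
  induction s using Finset.induction_on with
  | empty => simp
  | insert a s ha ih => rw [Finset.sum_insert ha, Finset.sum_insert ha, AlternatingMap.add_apply, ih]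

theorem curryLeft_curryLeft_swap {q : ℕ} (c : V [⋀^Fin (q + 2)]→ₗ[k] M) (x y : V) :
    (c.curryLeft x).curryLeft y = -(c.curryLeft y).curryLeft x := by
  have h := c.curryLeft_same (x + y)
  have h1 := c.curryLeft_same x
  have h2 := c.curryLeft_same y
  simp only [map_add, AlternatingMap.curryLeft_add, LinearMap.add_apply, h1, h2] at h
  rw [eq_neg_iff_add_eq_zero]
  simpa [add_comm] using h

theorem map_vecCons_vecCons_swap {q : ℕ} (c : V [⋀^Fin (q + 2)]→ₗ[k] M) (x y : V)
    (v : Fin q → V) :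
    c (Matrix.vecCons x (Matrix.vecCons y v)) = -c (Matrix.vecCons y (Matrix.vecCons x v)) :=
  DFunLike.congr_fun (curryLeft_curryLeft_swap c x y) v

/-- The exterior product `α ∧ c` of a linear form with an alternating form. -/
def wedge (α : V →ₗ[k] k) {q : ℕ} : V [⋀^Fin q]→ₗ[k] M →ₗ[k] V [⋀^Fin (q + 1)]→ₗ[k] M where
  toFun c := AlternatingMap.alternatizeUncurryFin (α.smulRight c)
  map_add' a b := by
    ext v
    simp [AlternatingMap.alternatizeUncurryFin_apply, Finset.sum_add_distrib]
  map_smul' f a := by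
    ext v
    simp only [AlternatingMap.alternatizeUncurryFin_apply, LinearMap.smulRight_apply,
      AlternatingMap.smul_apply, RingHom.id_apply, Finset.smul_sum]
    refine Finset.sum_congr rfl fun i _ => ?_
    rw [smul_comm _ f, smul_comm _ f]

theorem wedge_apply (α : V →ₗ[k] k) {q : ℕ} (c : V [⋀^Fin q]→ₗ[k] M) (v : Fin (q + 1) → V) :
    wedge α c v = ∑ i : Fin (q + 1), (-1) ^ (i : ℕ) • α (v i) • c (i.removeNth v) := by
  simp [wedge, AlternatingMap.alternatizeUncurryFin_apply]

/-- Contraction with a vector is an antiderivation. -/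
theorem wedge_curryLeft (α : V →ₗ[k] k) {q : ℕ} (c : V [⋀^Fin (q + 1)]→ₗ[k] M) (x : V) :
    (wedge α c).curryLeft x = α x • c - wedge α (c.curryLeft x) := by
  ext v
  rw [AlternatingMap.curryLeft_apply_apply, wedge_apply, Fin.sum_univ_succ, AlternatingMap.sub_apply,
    AlternatingMap.smul_apply, wedge_apply, sub_eq_add_neg, ← Finset.sum_neg_distrib]
  congr 1
  · simp [Matrix.vecCons]
  · refine Finset.sum_congr rfl fun i _ => ?_
    have : i.succ.removeNth (Matrix.vecCons x v) = Matrix.vecCons x (i.removeNth v) := by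
      funext j
      refine Fin.cases ?_ (fun j => ?_) j <;> simp [Fin.removeNth, Matrix.vecCons]
    rw [this, AlternatingMap.curryLeft_apply_apply]
    simp [pow_succ]

/-- The case of a form of degree zero, where the second term of `wedge_curryLeft` is missing. -/
theorem wedge_curryLeft_zero (α : V →ₗ[k] k) (c : V [⋀^Fin 0]→ₗ[k] M) (x : V) :
    (wedge α c).curryLeft x = α x • c := by
  ext v
  rw [AlternatingMap.curryLeft_apply_apply, wedge_apply]
  simp [Subsingleton.elim _ v]

theorem curryLeft_sub {q : ℕ} (a b : V [⋀^Fin (q + 1)]→ₗ[k] M) (x : V) :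
    (a - b).curryLeft x = a.curryLeft x - b.curryLeft x := by
  ext v
  simp

end Alternating

section Koszul

variable {k : Type*} [Field k] {n : ℕ}
variable {M N : Type*} [AddCommGroup M] [Module k M] [Module (MvPolynomial (Fin (n + 1)) k) M]
  [IsScalarTower k (MvPolynomial (Fin (n + 1)) k) M]
  [AddCommGroup N] [Module k N] [Module (MvPolynomial (Fin (n + 1)) k) N]
  [IsScalarTower k (MvPolynomial (Fin (n + 1)) k) N]

variable (k n) in
/-- The space `V = kⁿ⁺¹` of constant vector fields; `V* = ⟨dx₀, …, dxₙ⟩`. -/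
abbrev ConstVec : Type _ := Fin (n + 1) → k

variable (k n M) in
/-- The degree `q` term `M ⊗ ⋀^q V*` of the Koszul complex of `M`, encoded as the space of
`M`-valued alternating `q`-forms on `V`. -/
abbrev Kos (q : ℕ) : Type _ := (ConstVec k n) [⋀^Fin q]→ₗ[k] M

variable (k) in
/-- The constant vector field `∂/∂xᵢ`. -/
abbrev unitVec (i : Fin (n + 1)) : ConstVec k n := Pi.single i 1

omit [Module (MvPolynomial (Fin (n + 1)) k) M]
  [IsScalarTower k (MvPolynomial (Fin (n + 1)) k) M] in
theorem kos_ext {q : ℕ} {c c' : Kos k n M q}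
    (h : ∀ w : Fin q → Fin (n + 1), c (fun i => unitVec k (w i)) = c' fun i => unitVec k (w i)) :
    c = c' :=
  AlternatingMap.coe_multilinearMap_injective
    (Module.Basis.ext_multilinear (fun _ => Pi.basisFun k (Fin (n + 1))) fun w => by
      simpa using h w)

/-- The Koszul differential, the contraction with `∑ xᵢ ∂/∂xᵢ`. -/
def kosD (q : ℕ) : Kos k n M (q + 1) →ₗ[MvPolynomial (Fin (n + 1)) k] Kos k n M q where
  toFun c := ∑ i, (MvPolynomial.X i : MvPolynomial (Fin (n + 1)) k) • c.curryLeft (unitVec k i)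
  map_add' a b := by
    simp [Finset.sum_add_distrib]
  map_smul' f a := by
    ext v
    simp [alternatingMap_sum_apply, Finset.smul_sum, smul_comm f]

theorem kosD_eq_sum {q : ℕ} (c : Kos k n M (q + 1)) :
    kosD q c = ∑ i, (MvPolynomial.X i : MvPolynomial (Fin (n + 1)) k) •
      c.curryLeft (unitVec k i) := rfl

theorem kosD_apply {q : ℕ} (c : Kos k n M (q + 1)) (v : Fin q → ConstVec k n) :
    kosD q c v = ∑ i, (MvPolynomial.X i : MvPolynomial (Fin (n + 1)) k) •
      c (Matrix.vecCons (unitVec k i) v) := by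
  simp [kosD, alternatingMap_sum_apply]

theorem kosD_kosD {q : ℕ} (c : Kos k n M (q + 2)) : kosD q (kosD (q + 1) c) = 0 := by
  ext v
  simp only [kosD_apply, Finset.smul_sum, AlternatingMap.zero_apply]
  rw [← Finset.sum_product']
  -- antisymmetry of `c` pairs the terms `(i, j)` and `(j, i)`, and the diagonal terms vanish
  refine Finset.sum_involution (fun p _ => p.swap) (fun p _ => ?_) (fun p _ hp h => hp ?_)
    (fun _ _ => by simp) (fun _ _ => Prod.swap_swap _)
  · rw [Prod.fst_swap, Prod.snd_swap, map_vecCons_vecCons_swap, smul_neg, smul_neg,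
      smul_comm, neg_add_cancel]
  · obtain ⟨i, j⟩ := p
    obtain rfl : j = i := congrArg Prod.fst h
    rw [c.map_eq_zero_of_eq (i := 0) (j := 1) _ rfl (by simp), smul_zero, smul_zero]

/-- The map of Koszul complexes induced by a homomorphism of modules. -/
def kosMap (f : M →ₗ[MvPolynomial (Fin (n + 1)) k] N) (q : ℕ) :
    Kos k n M q →ₗ[MvPolynomial (Fin (n + 1)) k] Kos k n N q where
  toFun c := (f.restrictScalars k).compAlternatingMap c
  map_add' a b := by ext; simp
  map_smul' r a := by ext; simp

@[simp]
theorem kosMap_apply (f : M →ₗ[MvPolynomial (Fin (n + 1)) k] N) {q : ℕ} (c : Kos k n M q)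
    (v : Fin q → ConstVec k n) : kosMap f q c v = f (c v) := rfl

theorem kosD_kosMap (f : M →ₗ[MvPolynomial (Fin (n + 1)) k] N) {q : ℕ} (c : Kos k n M (q + 1)) :
    kosD q (kosMap f (q + 1) c) = kosMap f q (kosD q c) := by
  ext v
  simp [kosD_apply, map_sum]

omit [Module (MvPolynomial (Fin (n + 1)) k) M] [Module (MvPolynomial (Fin (n + 1)) k) N]
  [IsScalarTower k (MvPolynomial (Fin (n + 1)) k) M]
  [IsScalarTower k (MvPolynomial (Fin (n + 1)) k) N] in
/-- An alternating form with values in `f(W)` lifts to one with values in `W`: it suffices to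
compose it with a linear section of `f` over the vector space `f(W)`. -/
theorem exists_lift_alternating {V : Type*} [AddCommGroup V] [Module k V] (f : M →ₗ[k] N)
    (W : Submodule k M) {q : ℕ} (c : V [⋀^Fin q]→ₗ[k] N) (hc : ∀ v, ∃ m ∈ W, f m = c v) :
    ∃ z : V [⋀^Fin q]→ₗ[k] M, (∀ v, z v ∈ W) ∧ ∀ v, f (z v) = c v := by
  obtain ⟨s, hs⟩ := (f.domRestrict W).rangeRestrict.exists_rightInverse_of_surjective
    (LinearMap.range_rangeRestrict _)
  have hc' : ∀ v, c v ∈ LinearMap.range (f.domRestrict W) := fun v => by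
    obtain ⟨m, hm, e⟩ := hc v
    exact ⟨⟨m, hm⟩, e⟩
  refine ⟨(W.subtype ∘ₗ s).compAlternatingMap (c.codRestrict _ hc'), fun v => ?_, fun v => ?_⟩
  · simp
  · exact congrArg Subtype.val (LinearMap.congr_fun hs ⟨c v, hc' v⟩)

/-- Coefficientwise division by the coordinates: `D i` is a `k`-linear left inverse of the
multiplication by `xᵢ` which commutes with the multiplication by the other coordinates. -/
structure CoordDivision (M : Type*) [AddCommGroup M] [Module k M]
    [Module (MvPolynomial (Fin (n + 1)) k) M] where
  /-- division by `xᵢ` -/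
  D : Fin (n + 1) → M →ₗ[k] M
  D_self : ∀ i m, D i ((MvPolynomial.X i : MvPolynomial (Fin (n + 1)) k) • m) = m
  D_of_ne : ∀ i j m, j ≠ i → D i ((MvPolynomial.X j : MvPolynomial (Fin (n + 1)) k) • m) =
    (MvPolynomial.X j : MvPolynomial (Fin (n + 1)) k) • D i m

theorem wedge_smul (α : ConstVec k n →ₗ[k] k) {q : ℕ} (r : MvPolynomial (Fin (n + 1)) k)
    (c : Kos k n M q) : wedge α (r • c) = r • wedge α c := by
  ext v
  simp only [wedge_apply, AlternatingMap.smul_apply, Finset.smul_sum]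
  refine Finset.sum_congr rfl fun i _ => ?_
  rw [smul_comm r, smul_comm r]

/-- A cycle is homologous to a cycle which involves none of the `dxᵢ`, `i ∈ s`: with `D` the
division by `xᵢ`, the homotopy `c ↦ dxᵢ ∧ D c` replaces `c` by its restriction to `xᵢ = dxᵢ = 0`. -/
theorem CoordDivision.exists_homologous (E : CoordDivision (k := k) (n := n) M) {q : ℕ}
    (c : Kos k n M (q + 1)) (hc : kosD q c = 0) (s : Finset (Fin (n + 1))) :
    ∃ b : Kos k n M (q + 2), ∀ i ∈ s, (c - kosD (q + 1) b).curryLeft (unitVec k i) = 0 := by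
  classical
  induction s using Finset.induction_on with
  | empty => exact ⟨0, by simp⟩
  | insert i s hi ih =>
    obtain ⟨b, hb⟩ := ih
    set e := c - kosD (q + 1) b with he
    have hde : kosD q e = 0 := by rw [he, map_sub, hc, kosD_kosD, sub_zero]
    set α : ConstVec k n →ₗ[k] k := LinearMap.proj i with hα
    set De : Kos k n M (q + 1) := (E.D i).compAlternatingMap e with hDe
    -- the restriction of `e` to `xᵢ = 0`
    set r : Kos k n M (q + 1) := e - (MvPolynomial.X i : MvPolynomial (Fin (n + 1)) k) • De with hr
    have h1 : kosD q De = -r.curryLeft (unitVec k i) := by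
      have h0 : (E.D i).compAlternatingMap (kosD q e) = 0 := by rw [hde]; ext; simp
      ext v
      have h0v := DFunLike.congr_fun h0 v
      simp only [LinearMap.compAlternatingMap_apply, kosD_apply, map_sum,
        AlternatingMap.zero_apply] at h0v
      rw [← Finset.add_sum_erase _ _ (Finset.mem_univ i), E.D_self,
        Finset.sum_congr rfl fun j hj => E.D_of_ne i j _ (Finset.ne_of_mem_erase hj)] at h0v
      rw [kosD_apply, ← Finset.add_sum_erase _ _ (Finset.mem_univ i)]
      simp only [hr, hDe, AlternatingMap.neg_apply, AlternatingMap.curryLeft_apply_apply,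
        AlternatingMap.sub_apply, AlternatingMap.smul_apply, LinearMap.compAlternatingMap_apply]
      rw [eq_neg_of_add_eq_zero_right h0v]
      abel
    have h2 : e - kosD (q + 1) (wedge α De) = r - wedge α (r.curryLeft (unitVec k i)) := by
      have : kosD (q + 1) (wedge α De) =
          (MvPolynomial.X i : MvPolynomial (Fin (n + 1)) k) • De - wedge α (kosD q De) := by
        rw [kosD_eq_sum, kosD_eq_sum, map_sum]
        simp only [wedge_curryLeft, smul_sub, Finset.sum_sub_distrib, wedge_smul]
        congr 1
        rw [Finset.sum_eq_single i]
        · simp [hα]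
        · intro j _ hj
          simp [hα, hj.symm]
        · simp
      rw [this, h1, map_neg, hr]
      abel
    have hrs : ∀ j ∈ s, r.curryLeft (unitVec k j) = 0 := by
      intro j hj
      ext v
      have := DFunLike.congr_fun (hb j hj) v
      simp only [AlternatingMap.curryLeft_apply_apply, AlternatingMap.zero_apply] at this
      simp [hr, hDe, this]
    refine ⟨b + wedge α De, fun j hj => ?_⟩
    rw [map_add, ← sub_sub, ← he, h2, curryLeft_sub, sub_eq_zero, eq_comm]
    rw [Finset.mem_insert] at hj
    cases q with
    | zero =>
      rw [wedge_curryLeft_zero]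
      rcases hj with rfl | hj
      · simp [hα]
      · have hji : j ≠ i := fun h => hi (h ▸ hj)
        simp [hα, hji.symm, hrs j hj]
    | succ q =>
      rw [wedge_curryLeft]
      rcases hj with rfl | hj
      · simp [hα]
      · have hji : j ≠ i := fun h => hi (h ▸ hj)
        rw [curryLeft_curryLeft_swap, hrs j hj]
        simp [hα, hji.symm]

/-- The Koszul complex is exact in positive degrees. -/
theorem CoordDivision.exists_kosD_eq (E : CoordDivision (k := k) (n := n) M) {q : ℕ}
    (c : Kos k n M (q + 1)) (hc : kosD q c = 0) : ∃ b, kosD (q + 1) b = c := by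
  obtain ⟨b, hb⟩ := E.exists_homologous c hc Finset.univ
  refine ⟨b, (sub_eq_zero.1 ?_).symm⟩
  refine kos_ext fun w => ?_
  have := DFunLike.congr_fun (hb (w 0) (Finset.mem_univ _)) (fun i => unitVec k (w i.succ))
  rw [AlternatingMap.curryLeft_apply_apply, AlternatingMap.zero_apply] at this
  rw [AlternatingMap.zero_apply, ← this]
  congr 1
  funext i
  refine Fin.cases ?_ (fun i => ?_) i <;> simp

end Koszul

/-! ### Koszul homology and resolutions -/

section Zigzag

universe v

variable {k : Type*} [Field k] {n : ℕ}

variable (k n) in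
/-- The submodule `(x₀, …, xₙ) M`, described as the image of the Koszul differential. -/
def irrelevantSMul (M : Type*) [AddCommGroup M] [Module k M]
    [Module (MvPolynomial (Fin (n + 1)) k) M] [IsScalarTower k (MvPolynomial (Fin (n + 1)) k) M] :
    Submodule (MvPolynomial (Fin (n + 1)) k) M where
  carrier := {m | ∃ c : Kos k n M 1, kosD 0 c ![] = m}
  zero_mem' := ⟨0, by simp⟩
  add_mem' := by
    rintro _ _ ⟨a, rfl⟩ ⟨b, rfl⟩
    exact ⟨a + b, by simp⟩
  smul_mem' := by
    rintro r _ ⟨a, rfl⟩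
    exact ⟨r • a, by simp⟩

/-- The condition to be a cycle of the Koszul complex; it is empty in degree zero. -/
def KosCycle {M : Type*} [AddCommGroup M] [Module k M]
    [Module (MvPolynomial (Fin (n + 1)) k) M] [IsScalarTower k (MvPolynomial (Fin (n + 1)) k) M] :
    ∀ {q : ℕ}, Kos k n M q → Prop
  | 0, _ => True
  | q + 1, c => kosD q c = 0

/-- For a complex `⋯ → G 1 → G 0 → M`, a Koszul `q`-form `c` with values in `M` and `y ∈ G q`, the
statement that there is a zigzag from `c` to `y` in the double complex `G ⊗ ⋀ V*`: forms
`z_i ∈ G i ⊗ ⋀^{q-i} V*` such that `z_0 ↦ c`, `z_{i+1} ↦ ∂ z_i`, `z_q = y`. -/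
def Zigzag : ∀ (q : ℕ) {M : Type v} [AddCommGroup M] [Module k M]
    [Module (MvPolynomial (Fin (n + 1)) k) M] [IsScalarTower k (MvPolynomial (Fin (n + 1)) k) M]
    {G : ℕ → Type v} [∀ j, AddCommGroup (G j)] [∀ j, Module k (G j)]
    [∀ j, Module (MvPolynomial (Fin (n + 1)) k) (G j)]
    [∀ j, IsScalarTower k (MvPolynomial (Fin (n + 1)) k) (G j)]
    (_aug : G 0 →ₗ[MvPolynomial (Fin (n + 1)) k] M)
    (_d : ∀ j, G (j + 1) →ₗ[MvPolynomial (Fin (n + 1)) k] G j) (_c : Kos k n M q) (_y : G q), Prop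
  | 0, _, _, _, _, _, _, _, _, _, _, aug, _, c, y => aug y = c ![]
  | q + 1, _, _, _, _, _, G, _, _, _, _, aug, d, c, y =>
    ∃ z : Kos k n (G 0) (q + 1), kosMap aug (q + 1) z = c ∧
      Zigzag q (G := fun j => G (j + 1)) (d 0) (fun j => d (j + 1)) (kosD q z) y

variable {M : Type v} [AddCommGroup M] [Module k M]
    [Module (MvPolynomial (Fin (n + 1)) k) M] [IsScalarTower k (MvPolynomial (Fin (n + 1)) k) M]
    {G : ℕ → Type v} [∀ j, AddCommGroup (G j)] [∀ j, Module k (G j)]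
    [∀ j, Module (MvPolynomial (Fin (n + 1)) k) (G j)]
    [∀ j, IsScalarTower k (MvPolynomial (Fin (n + 1)) k) (G j)]
    {aug : G 0 →ₗ[MvPolynomial (Fin (n + 1)) k] M}
    {d : ∀ j, G (j + 1) →ₗ[MvPolynomial (Fin (n + 1)) k] G j}

theorem Zigzag.add {q : ℕ} {c c' : Kos k n M q} {y y' : G q} (h : Zigzag q aug d c y)
    (h' : Zigzag q aug d c' y') : Zigzag q aug d (c + c') (y + y') := by
  induction q generalizing M G with
  | zero =>
    simp only [Zigzag] at h h' ⊢
    rw [map_add, h, h', AlternatingMap.add_apply]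
  | succ q ih =>
    obtain ⟨z, hz, h⟩ := h
    obtain ⟨z', hz', h'⟩ := h'
    refine ⟨z + z', by rw [map_add, hz, hz'], ?_⟩
    rw [map_add]
    exact ih h h'

theorem Zigzag.smul {q : ℕ} (r : MvPolynomial (Fin (n + 1)) k) {c : Kos k n M q} {y : G q}
    (h : Zigzag q aug d c y) : Zigzag q aug d (r • c) (r • y) := by
  induction q generalizing M G with
  | zero =>
    simp only [Zigzag] at h ⊢
    rw [map_smul, h, AlternatingMap.smul_apply]
  | succ q ih =>
    obtain ⟨z, hz, h⟩ := h
    refine ⟨r • z, by rw [map_smul, hz], ?_⟩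
    rw [map_smul]
    exact ih h

theorem zigzag_zero {q : ℕ} : Zigzag q aug d (0 : Kos k n M q) (0 : G q) := by
  induction q generalizing M G with
  | zero => simp [Zigzag]
  | succ q ih =>
    refine ⟨0, by rw [map_zero], ?_⟩
    rw [map_zero]
    exact ih

/-- Every Koszul cycle with values in the image of the augmentation starts a zigzag, and if the
cycle is homogeneous, the zigzag can be chosen homogeneous. Here `W` and `W'` are families of
subspaces with the properties of the homogeneous parts. -/
theorem exists_zigzag {W : ∀ j, ℤ → Submodule k (G j)} {W' : ℤ → Submodule k M} {q : ℕ}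
    (hd : ∀ j, Function.Exact (d (j + 1)) (d j)) (haug : Function.Exact (d 0) aug)
    (hWX : ∀ j i m, ∀ y ∈ W j m, (MvPolynomial.X i : MvPolynomial (Fin (n + 1)) k) • y ∈ W j (m + 1))
    (hW' : ∀ m, ∀ x ∈ W' m, x ∈ LinearMap.range aug → ∃ y ∈ W 0 m, aug y = x)
    (hW : ∀ j m, ∀ x ∈ W j m, x ∈ LinearMap.range (d j) → ∃ y ∈ W (j + 1) m, d j y = x)
    {m : ℤ} (c : Kos k n M q) (hc : KosCycle c) (hcm : ∀ v, c v ∈ W' m)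
    (hcr : ∀ v, c v ∈ LinearMap.range aug) :
    ∃ y ∈ W q (m + q), Zigzag q aug d c y := by
  induction q generalizing M G m with
  | zero =>
    obtain ⟨y, hy, h⟩ := hW' m _ (hcm ![]) (hcr ![])
    exact ⟨y, by simpa using hy, h⟩
  | succ q ih =>
    obtain ⟨z, hzW, hz⟩ := exists_lift_alternating (aug.restrictScalars k) (W 0 m) c
      fun v => hW' m _ (hcm v) (hcr v)
    have hzc : kosMap aug (q + 1) z = c := by
      ext v
      exact hz v
    have hc' : kosD q c = 0 := hc
    obtain ⟨y, hy, h⟩ := ih (G := fun j => G (j + 1)) (aug := d 0) (d := fun j => d (j + 1))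
      (W := fun j => W (j + 1)) (W' := W 0) (m := m + 1)
      (fun j => hd (j + 1)) (hd 0) (fun j => hWX (j + 1)) (hW 0) (fun j => hW (j + 1)) (kosD q z)
      (by
        cases q with
        | zero => trivial
        | succ q => exact kosD_kosD z)
      (fun v => by
        rw [kosD_apply]
        exact Submodule.sum_mem _ fun i _ => hWX 0 i m _ (hzW _))
      (fun v => by
        refine (haug _).1 ?_
        rw [← kosMap_apply, ← kosD_kosMap, hzc, hc']
        rfl)
    refine ⟨y, ?_, z, hzc, h⟩
    have e : m + ((q + 1 : ℕ) : ℤ) = m + 1 + q := by push_cast; ring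
    rw [e]
    exact hy

/-- The end of a zigzag vanishes in `coker d ⊗ k` if and only if its start is the boundary of a
form with values in the image of the augmentation. -/
theorem Zigzag.end_mem_iff {q : ℕ} (hd : ∀ j, Function.Exact (d (j + 1)) (d j))
    (haug : Function.Exact (d 0) aug)
    (hK : ∀ j q (c : Kos k n (G j) (q + 1)), kosD q c = 0 → ∃ b, kosD (q + 1) b = c)
    {c : Kos k n M q} {y : G q} (h : Zigzag q aug d c y) :
    y ∈ LinearMap.range (d q) ⊔ irrelevantSMul k n (G q) ↔
      ∃ b : Kos k n (G 0) (q + 1), kosD q (kosMap aug (q + 1) b) = c := by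
  induction q generalizing M G with
  | zero =>
    have h' : aug y = c ![] := h
    constructor
    · intro hy
      obtain ⟨_, ⟨u, rfl⟩, _, ⟨b, rfl⟩, rfl⟩ := Submodule.mem_sup.1 hy
      refine ⟨b, ?_⟩
      ext v
      rw [Subsingleton.elim v ![], ← h', map_add, (haug _).2 ⟨u, rfl⟩, zero_add (aug _)]
      exact DFunLike.congr_fun (kosD_kosMap aug b) ![]
    · rintro ⟨b, rfl⟩
      have : aug (y - kosD 0 b ![]) = 0 := by
        rw [map_sub, h', sub_eq_zero]
        exact DFunLike.congr_fun (kosD_kosMap aug b) ![]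
      obtain ⟨u, hu⟩ := (haug _).1 this
      exact Submodule.mem_sup.2 ⟨_, ⟨u, rfl⟩, _, ⟨b, rfl⟩, by rw [hu, sub_add_cancel]⟩
  | succ q ih =>
    obtain ⟨z, rfl, h⟩ := h
    refine (ih (G := fun j => G (j + 1)) (fun j => hd (j + 1)) (hd 0) (fun j => hK (j + 1)) h).trans
      ?_
    constructor
    · rintro ⟨b, hb⟩
      obtain ⟨u, hu⟩ := hK 0 _ (z - kosMap (d 0) _ b) (by rw [map_sub, hb, sub_self])
      refine ⟨u, ?_⟩
      rw [kosD_kosMap, hu]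
      ext v
      simp [(haug _).2 ⟨b v, rfl⟩]
    · rintro ⟨b, hb⟩
      obtain ⟨u, -, hu⟩ := exists_lift_alternating ((d 0).restrictScalars k) ⊤
        (z - kosD (q + 1) b) fun v => by
          have : aug ((z - kosD (q + 1) b) v) = 0 := by
            rw [AlternatingMap.sub_apply, map_sub, ← kosMap_apply, ← kosMap_apply, ← kosD_kosMap,
              hb, sub_self]
          obtain ⟨u, hu⟩ := (haug _).1 this
          exact ⟨u, trivial, hu⟩
      refine ⟨u, ?_⟩
      have : kosMap (d 0) _ u = z - kosD (q + 1) b := by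
        ext v
        exact hu v
      rw [this, map_sub, kosD_kosD, sub_zero]

/-- The end of a zigzag is a cycle of `G ⊗ k`. -/
theorem Zigzag.d_end_mem {q : ℕ} {c : Kos k n M (q + 1)} {y : G (q + 1)}
    (h : Zigzag (q + 1) aug d c y) : d q y ∈ irrelevantSMul k n (G q) := by
  induction q generalizing M G with
  | zero =>
    obtain ⟨z, -, h⟩ := h
    exact ⟨z, h.symm⟩
  | succ q ih =>
    obtain ⟨z, -, h⟩ := h
    exact ih h

/-- In positive degree, every cycle of `G ⊗ k` is the end of a zigzag which starts in a cycle. -/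
theorem exists_zigzag_end {q : ℕ} (hd : ∀ j, Function.Exact (d (j + 1)) (d j))
    (haug : Function.Exact (d 0) aug)
    (hK : ∀ j q (c : Kos k n (G j) (q + 1)), kosD q c = 0 → ∃ b, kosD (q + 1) b = c)
    (y : G (q + 1)) (hy : d q y ∈ irrelevantSMul k n (G q)) :
    ∃ z : Kos k n (G 0) (q + 1), kosD q (kosMap aug (q + 1) z) = 0 ∧
      Zigzag (q + 1) aug d (kosMap aug (q + 1) z) y := by
  induction q generalizing M G with
  | zero =>
    obtain ⟨z, hz⟩ := hy
    refine ⟨z, ?_, z, rfl, hz.symm⟩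
    ext v
    rw [kosD_kosMap, kosMap_apply, Subsingleton.elim v ![], hz, (haug _).2 ⟨y, rfl⟩]
    rfl
  | succ q ih =>
    obtain ⟨z, hz, h⟩ := ih (G := fun j => G (j + 1)) (aug := d 0) (d := fun j => d (j + 1))
      (fun j => hd (j + 1)) (hd 0) (fun j => hK (j + 1)) y hy
    obtain ⟨b, hb⟩ := hK 0 _ _ hz
    refine ⟨b, ?_, b, rfl, by rwa [hb]⟩
    rw [kosD_kosMap, hb]
    ext v
    simp [(haug _).2 ⟨z v, rfl⟩]

end Zigzag

/-! ### Homogeneous components -/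

section Graded

variable {k : Type u} [Field k] {n : ℕ}

theorem mem_polyDegree_iff {m : ℤ} {f : Poly k n} :
    f ∈ polyDegree k n m ↔ ∀ s, f.coeff s ≠ 0 → (s.degree : ℤ) = m := by
  unfold polyDegree
  split_ifs with h
  · rw [MvPolynomial.mem_homogeneousSubmodule]
    refine forall₂_congr fun s _ => ?_
    have e : Finsupp.weight (1 : Fin (n + 1) → ℕ) s = s.degree :=
      (DFunLike.congr_fun (Finsupp.degree_eq_weight_one (R := ℕ)) s).symm
    rw [e]
    omega
  · rw [Submodule.mem_bot]
    constructor
    · rintro rfl s hs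
      simp at hs
    · intro hf
      ext s
      by_contra hs
      exact h (hf s hs ▸ by positivity)

variable (k n) in
/-- The homogeneous component of degree `m`, for an integer `m`. -/
def polyComponent (m : ℤ) : Poly k n →ₗ[k] Poly k n :=
  if 0 ≤ m then MvPolynomial.homogeneousComponent m.toNat else 0

theorem coeff_polyComponent (m : ℤ) (f : Poly k n) (s : Fin (n + 1) →₀ ℕ) :
    (polyComponent k n m f).coeff s = if (s.degree : ℤ) = m then f.coeff s else 0 := by
  unfold polyComponent
  split_ifs with h h' h'
  · rw [MvPolynomial.coeff_homogeneousComponent, if_pos (by omega)]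
  · rw [MvPolynomial.coeff_homogeneousComponent, if_neg (by omega)]
  · omega
  · simp

theorem polyComponent_mem (m : ℤ) (f : Poly k n) : polyComponent k n m f ∈ polyDegree k n m := by
  rw [mem_polyDegree_iff]
  intro s hs
  rw [coeff_polyComponent] at hs
  by_contra h
  exact hs (if_neg h)

theorem polyComponent_eq_self {m : ℤ} {f : Poly k n} (hf : f ∈ polyDegree k n m) :
    polyComponent k n m f = f := by
  ext s
  rw [coeff_polyComponent]
  split_ifs with h
  · rfl
  · by_contra h'
    exact h (mem_polyDegree_iff.1 hf s (Ne.symm h'))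

theorem polyComponent_of_ne {m m' : ℤ} {f : Poly k n} (hf : f ∈ polyDegree k n m) (h : m' ≠ m) :
    polyComponent k n m' f = 0 := by
  ext s
  rw [coeff_polyComponent]
  split_ifs with h'
  · by_contra hs
    exact h (h' ▸ mem_polyDegree_iff.1 hf s hs)
  · rfl

theorem mul_mem_polyDegree {m m' : ℤ} {f g : Poly k n} (hf : f ∈ polyDegree k n m)
    (hg : g ∈ polyDegree k n m') : f * g ∈ polyDegree k n (m + m') := by
  classical
  rw [mem_polyDegree_iff] at *
  intro s hs
  rw [MvPolynomial.coeff_mul] at hs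
  obtain ⟨⟨a, b⟩, hab, h⟩ := Finset.exists_ne_zero_of_sum_ne_zero hs
  rw [Finset.HasAntidiagonal.mem_antidiagonal] at hab
  rw [← hf a (left_ne_zero_of_mul h), ← hg b (right_ne_zero_of_mul h), ← hab, map_add]
  push_cast
  rfl

theorem X_mem_polyDegree (i : Fin (n + 1)) : (MvPolynomial.X i : Poly k n) ∈ polyDegree k n 1 := by
  rw [polyDegree, if_pos zero_le_one]
  exact MvPolynomial.isHomogeneous_X k i

theorem mem_polyDegree_natCast {m : ℕ} {f : Poly k n} :
    f ∈ polyDegree k n m ↔ f ∈ grading k n m := by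
  rw [polyDegree, if_pos (by positivity), Int.toNat_natCast]

theorem polyDegree_of_neg {m : ℤ} (hm : m < 0) : polyDegree k n m = ⊥ :=
  if_neg (by omega)

theorem sum_polyComponent {f : Poly k n} {N : ℕ} (hN : f.totalDegree < N) :
    ∑ m ∈ Finset.range N, polyComponent k n m f = f := by
  ext s
  rw [MvPolynomial.coeff_sum]
  simp only [coeff_polyComponent, Nat.cast_inj]
  rw [Finset.sum_ite_eq]
  split_ifs with h
  · rfl
  · refine (MvPolynomial.coeff_eq_zero_of_totalDegree_lt ?_).symm
    rw [Finset.mem_range] at h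
    change _ < s.degree
    omega

theorem polyComponent_mul {m e : ℤ} (f : Poly k n) {g : Poly k n} (hg : g ∈ polyDegree k n e) :
    polyComponent k n m (f * g) = polyComponent k n (m - e) f * g := by
  conv_lhs => rw [← sum_polyComponent (Nat.lt_succ_self f.totalDegree), Finset.sum_mul, map_sum]
  conv_rhs => rw [← sum_polyComponent (Nat.lt_succ_self f.totalDegree), map_sum, Finset.sum_mul]
  refine Finset.sum_congr rfl fun i _ => ?_
  have h := polyComponent_mem (i : ℤ) f
  by_cases hi : m = i + e
  · rw [hi, polyComponent_eq_self (mul_mem_polyDegree h hg), add_sub_cancel_right,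
      polyComponent_eq_self h]
  · rw [polyComponent_of_ne (mul_mem_polyDegree h hg) hi, polyComponent_of_ne h (by omega),
      zero_mul]

/-- A family of subspaces is an internal grading if there are projections, possibly defined on a
larger space only. -/
theorem isInternal_of_projections {K N N' : Type*} [Field K] [AddCommGroup N] [Module K N]
    [AddCommGroup N'] (A : ℤ → Submodule K N) (j : N →+ N') (hj : Function.Injective j)
    (π : ℤ → N' →+ N') (h1 : ∀ d, ∀ x ∈ A d, π d (j x) = j x)
    (h2 : ∀ d e, e ≠ d → ∀ x ∈ A d, π e (j x) = 0) (h3 : ∀ x, x ∈ ⨆ d, A d) :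
    DirectSum.IsInternal A := by
  refine DirectSum.isInternal_submodule_of_iSupIndep_of_iSup_eq_top ?_ (eq_top_iff.2 fun x _ => h3 x)
  rw [iSupIndep_def]
  intro d
  rw [Submodule.disjoint_def]
  intro x hx hx'
  have : π d (j x) = 0 := by
    refine Submodule.iSup_induction _ (motive := fun x => π d (j x) = 0) hx' (fun e y hy => ?_)
      (by simp) (fun a b ha hb => by rw [map_add, map_add, ha, hb, add_zero])
    by_cases he : e = d
    · subst he
      simp only [ne_eq, not_true_eq_false, iSup_false, Submodule.mem_bot] at hy
      simp [hy]
    · rw [iSup_pos he] at hy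
      exact h2 e d (Ne.symm he) y hy
  rw [h1 d x hx] at this
  exact hj (by rw [this, map_zero])

/-- The homogeneous component of degree `m` in the graded free module with basis elements of
degrees `deg`. -/
def freeComponent {γ : Type*} (deg : γ → ℤ) (m : ℤ) : (γ →₀ Poly k n) →ₗ[k] (γ →₀ Poly k n) :=
  Finsupp.lsum k fun b => Finsupp.lsingle b ∘ₗ polyComponent k n (m - deg b)

theorem freeComponent_single {γ : Type*} (deg : γ → ℤ) (m : ℤ) (b : γ) (f : Poly k n) :
    freeComponent deg m (Finsupp.single b f) =
      Finsupp.single b (polyComponent k n (m - deg b) f) := by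
  simp [freeComponent]

theorem freeComponent_apply {γ : Type*} (deg : γ → ℤ) (m : ℤ) (y : γ →₀ Poly k n) (b : γ) :
    freeComponent deg m y b = polyComponent k n (m - deg b) (y b) := by
  classical
  induction y using Finsupp.induction_linear with
  | zero => simp
  | add y z hy hz => rw [map_add, Finsupp.add_apply, hy, hz, Finsupp.add_apply, map_add]
  | single c f =>
    rw [freeComponent_single, Finsupp.single_apply, Finsupp.single_apply]
    split_ifs with h
    · rw [h]
    · simp

/-- The homogeneous elements of degree `m` in the graded free module with basis elements of
degrees `deg`. -/
def freeDegree {γ : Type*} (deg : γ → ℤ) (m : ℤ) : Submodule k (γ →₀ Poly k n) where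
  carrier := {y | ∀ b, y b ∈ polyDegree k n (m - deg b)}
  zero_mem' _ := Submodule.zero_mem _
  add_mem' hy hz b := Submodule.add_mem _ (hy b) (hz b)
  smul_mem' c _ hy b := Submodule.smul_mem _ c (hy b)

theorem freeComponent_mem {γ : Type*} (deg : γ → ℤ) (m : ℤ) (y : γ →₀ Poly k n) :
    freeComponent deg m y ∈ freeDegree (k := k) deg m := fun b => by
  rw [freeComponent_apply]
  exact polyComponent_mem _ _

theorem freeComponent_eq_self {γ : Type*} {deg : γ → ℤ} {m : ℤ} {y : γ →₀ Poly k n}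
    (hy : y ∈ freeDegree (k := k) deg m) : freeComponent deg m y = y := by
  ext1 b
  rw [freeComponent_apply, polyComponent_eq_self (hy b)]

/-- A functional which is homogeneous on the basis is compatible with homogeneous components. -/
theorem polyComponent_functional {γ : Type*} (deg : γ → ℤ) (ψ : (γ →₀ Poly k n) →ₗ[Poly k n] Poly k n)
    (e : ℤ) (hψ : ∀ b, ψ (Finsupp.single b 1) ∈ polyDegree k n (deg b - e)) (m : ℤ)
    (y : γ →₀ Poly k n) : polyComponent k n (m - e) (ψ y) = ψ (freeComponent deg m y) := by
  induction y using Finsupp.induction_linear with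
  | zero => simp
  | add y z hy hz => rw [map_add, map_add, map_add, map_add, hy, hz]
  | single b f =>
    have h : ∀ g : Poly k n, ψ (Finsupp.single b g) = g * ψ (Finsupp.single b 1) := fun g => by
      rw [← smul_eq_mul, ← map_smul, Finsupp.smul_single, smul_eq_mul, mul_one]
    have e' : m - e - (deg b - e) = m - deg b := by ring
    rw [freeComponent_single, h f, h (polyComponent k n (m - deg b) f),
      polyComponent_mul _ (hψ b), e']

theorem freeComponent_map {γ γ' : Type*} (deg : γ → ℤ) (deg' : γ' → ℤ)
    (φ : (γ →₀ Poly k n) →ₗ[Poly k n] (γ' →₀ Poly k n))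
    (hφ : ∀ b c, φ (Finsupp.single b 1) c ∈ polyDegree k n (deg b - deg' c)) (m : ℤ)
    (y : γ →₀ Poly k n) : freeComponent deg' m (φ y) = φ (freeComponent deg m y) := by
  ext1 c
  rw [freeComponent_apply]
  exact polyComponent_functional deg (Finsupp.lapply c ∘ₗ φ) (deg' c) (fun b => hφ b c) m y

theorem exists_sum_freeComponent {γ : Type*} (deg : γ → ℤ) (y : γ →₀ Poly k n) :
    ∃ s : Finset ℤ, ∑ m ∈ s, freeComponent deg m y = y := by
  classical
  refine ⟨y.support.biUnion fun b => (Finset.range ((y b).totalDegree + 1)).image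
    fun i : ℕ => (i : ℤ) + deg b, ?_⟩
  ext1 b
  rw [Finsupp.finsetSum_apply]
  simp only [freeComponent_apply]
  by_cases hb : y b = 0
  · simp [hb]
  rw [← Finset.sum_subset (Finset.subset_biUnion_of_mem (fun b => (Finset.range
      ((y b).totalDegree + 1)).image fun i : ℕ => (i : ℤ) + deg b) (Finsupp.mem_support_iff.2 hb))]
  · rw [Finset.sum_image (fun i _ j _ h => by simpa using h)]
    simp only [add_sub_cancel_right]
    exact sum_polyComponent (Nat.lt_succ_self _)
  · intro m _ hm
    ext s
    rw [coeff_polyComponent]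
    split_ifs with h
    · refine MvPolynomial.coeff_eq_zero_of_totalDegree_lt ?_
      by_contra hlt
      refine hm (Finset.mem_image.2 ⟨s.degree, Finset.mem_range.2 ?_, by omega⟩)
      change ¬ _ < s.degree at hlt
      omega
    · rfl

end Graded

/-! ### Tor as Koszul homology -/

section Tor

variable {k : Type u} [Field k] {n : ℕ}

variable (k n) in
/-- The quotient of a polynomial by `xᵢ`, dropping the remainder. -/
def divCoord (i : Fin (n + 1)) : Poly k n →ₗ[k] Poly k n where
  toFun f := f.divMonomial (Finsupp.single i 1)
  map_add' f g := MvPolynomial.add_divMonomial f g _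
  map_smul' c f := by
    ext s
    simp [MvPolynomial.coeff_divMonomial]

theorem divCoord_X_mul (i : Fin (n + 1)) (f : Poly k n) :
    divCoord k n i (MvPolynomial.X i * f) = f :=
  MvPolynomial.X_mul_divMonomial i f

theorem divCoord_X_mul_of_ne {i j : Fin (n + 1)} (h : j ≠ i) (f : Poly k n) :
    divCoord k n i (MvPolynomial.X j * f) = MvPolynomial.X j * divCoord k n i f := by
  classical
  ext s
  change MvPolynomial.coeff s (MvPolynomial.divMonomial _ _) =
    MvPolynomial.coeff s (_ * MvPolynomial.divMonomial _ _)
  rw [MvPolynomial.coeff_divMonomial, MvPolynomial.coeff_X_mul', MvPolynomial.coeff_X_mul',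
    MvPolynomial.coeff_divMonomial]
  have e : j ∈ (Finsupp.single i 1 + s).support ↔ j ∈ s.support := by
    simp [h.symm]
  simp only [e]
  split_ifs with hs
  · rw [add_tsub_assoc_of_le]
    rw [Finsupp.single_le_iff]
    exact Nat.one_le_iff_ne_zero.2 (Finsupp.mem_support_iff.1 hs)
  · rfl

variable (k n) in
/-- Division by the coordinates in a free module. -/
def freeCoordDivision (γ : Type*) : CoordDivision (k := k) (n := n) (γ →₀ Poly k n) where
  D i := Finsupp.mapRange.linearMap (divCoord k n i)
  D_self i m := by
    ext1 b
    exact divCoord_X_mul i (m b)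
  D_of_ne i j m h := by
    ext1 b
    exact divCoord_X_mul_of_ne h (m b)

theorem X_smul_mem_irrelevantSMul {M : Type*} [AddCommGroup M] [Module k M] [Module (Poly k n) M]
    [IsScalarTower k (Poly k n) M] (i : Fin (n + 1)) (m : M) :
    (MvPolynomial.X i : Poly k n) • m ∈ irrelevantSMul k n M := by
  refine ⟨wedge (LinearMap.proj i) (AlternatingMap.constOfIsEmpty k _ (Fin 0) m), ?_⟩
  rw [kosD_eq_sum, alternatingMap_sum_apply, Finset.sum_eq_single i]
  · simp [wedge_curryLeft_zero]
  · intro j _ hj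
    simp [wedge_curryLeft_zero, hj.symm]
  · simp

/-- Reduction of a free module modulo `(x₀, …, xₙ)`. -/
def freeReduce (γ : Type*) : (γ →₀ Poly k n) →ₗ[k] (γ →₀ k) :=
  Finsupp.mapRange.linearMap (MvPolynomial.lcoeff k 0)

theorem freeReduce_apply {γ : Type*} (y : γ →₀ Poly k n) (b : γ) :
    freeReduce γ y b = MvPolynomial.constantCoeff (y b) := rfl

theorem freeReduce_smul {γ : Type*} (r : Poly k n) (y : γ →₀ Poly k n) :
    freeReduce γ (r • y) = MvPolynomial.constantCoeff r • freeReduce γ y := by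
  ext1 b
  simp [freeReduce_apply]

theorem mem_irrelevantSMul_iff {γ : Type*} (y : γ →₀ Poly k n) :
    y ∈ irrelevantSMul k n (γ →₀ Poly k n) ↔ freeReduce γ y = 0 := by
  constructor
  · rintro ⟨c, rfl⟩
    rw [kosD_apply, map_sum]
    refine Finset.sum_eq_zero fun i _ => ?_
    rw [freeReduce_smul, MvPolynomial.constantCoeff_X, zero_smul]
  · intro h
    rw [← Finsupp.sum_single y]
    refine Submodule.sum_mem _ fun b _ => ?_
    have hb : y b ∈ MvPolynomial.idealOfVars (Fin (n + 1)) k := by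
      rw [← pow_one (MvPolynomial.idealOfVars _ _), MvPolynomial.mem_pow_idealOfVars_iff']
      intro s hs
      rw [Nat.lt_one_iff, Finsupp.degree_eq_zero_iff] at hs
      rw [hs]
      exact DFunLike.congr_fun h b
    change Finsupp.single b (y b) ∈ _
    refine Submodule.span_induction ?_ ?_ ?_ ?_ hb
    · rintro _ ⟨i, rfl⟩
      have := X_smul_mem_irrelevantSMul (k := k) i (Finsupp.single b (1 : Poly k n))
      rwa [Finsupp.smul_single, smul_eq_mul, mul_one] at this
    · rw [Finsupp.single_zero]
      exact Submodule.zero_mem _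
    · intro f g _ _ hf hg
      rw [Finsupp.single_add]
      exact Submodule.add_mem _ hf hg
    · intro r f _ hf
      rw [← Finsupp.smul_single]
      exact Submodule.smul_mem _ r hf

/-- A linear map which kills the kernel of a surjection factors through it. -/
theorem exists_factor_of_surjective {R A B C : Type*} [CommRing R] [AddCommGroup A] [Module R A]
    [AddCommGroup B] [Module R B] [AddCommGroup C] [Module R C] (π : A →ₗ[R] B)
    (hπ : Function.Surjective π) (τ : A →ₗ[R] C) (h : ∀ a, π a = 0 → τ a = 0) :
    ∃ β : B →ₗ[R] C, ∀ a, β (π a) = τ a := by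
  refine ⟨((LinearMap.ker π).liftQ τ fun a ha => h a ha) ∘ₗ (π.quotKerEquivOfSurjective hπ).symm, fun a => ?_⟩
  have : (π.quotKerEquivOfSurjective hπ).symm (π a) = (LinearMap.ker π).mkQ a := by
    rw [LinearEquiv.symm_apply_eq]
    rfl
  rw [LinearMap.comp_apply, LinearEquiv.coe_coe, this]
  rfl

/-- The cycles of degree `p` in the Koszul complex `I ⊗ ⋀ V*`. -/
def kosCycles (I : Ideal (Poly k n)) (p : ℕ) : Submodule (Poly k n) (Kos k n (Poly k n) p) where
  carrier := {c | (∀ v, c v ∈ I) ∧ KosCycle c}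
  zero_mem' := ⟨fun v => I.zero_mem, by cases p with
    | zero => trivial
    | succ p => exact map_zero _⟩
  add_mem' := by
    rintro a b ⟨ha, ha'⟩ ⟨hb, hb'⟩
    refine ⟨fun v => I.add_mem (ha v) (hb v), ?_⟩
    cases p with
    | zero => trivial
    | succ p =>
      change kosD p (a + b) = 0
      rw [map_add, show kosD p a = 0 from ha', show kosD p b = 0 from hb', add_zero]
  smul_mem' := by
    rintro r a ⟨ha, ha'⟩
    refine ⟨fun v => I.mul_mem_left r (ha v), ?_⟩
    cases p with
    | zero => trivial
    | succ p =>
      change kosD p (r • a) = 0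
      rw [map_smul, show kosD p a = 0 from ha', smul_zero]

namespace GradedFreeResolution

variable {I : Ideal (Poly k n)} (F : GradedFreeResolution I)

/-- The reduction `F_p → F_p ⊗ k`. -/
def reduce (p : ℕ) : (F.gen p →₀ Poly k n) →ₗ[k] F.Fiber p := freeReduce (F.gen p)

/-- The class in `Tor_p(I, k)` of a cycle. -/
def torMk (p : ℕ) : F.cycles p →ₗ[k] F.Tor p := (F.boundaries p).mkQ

theorem torMk_surjective (p : ℕ) : Function.Surjective (F.torMk p) :=
  (F.boundaries p).mkQ_surjective

theorem torMk_eq_zero_iff {p : ℕ} (u : F.cycles p) :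
    F.torMk p u = 0 ↔ (u : F.Fiber p) ∈ LinearMap.range (F.dBar p) :=
  Submodule.Quotient.mk_eq_zero _

theorem torMk_smul {p : ℕ} (r : Poly k n) (u : F.cycles p) :
    F.torMk p (MvPolynomial.constantCoeff r • u) = r • F.torMk p u :=
  map_smul (F.torMk p) _ _

theorem reduce_smul {p : ℕ} (r : Poly k n) (y : F.gen p →₀ Poly k n) :
    F.reduce p (r • y) = MvPolynomial.constantCoeff r • F.reduce p y :=
  freeReduce_smul r y

theorem reduce_eq_zero_iff {p : ℕ} (y : F.gen p →₀ Poly k n) :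
    F.reduce p y = 0 ↔ y ∈ irrelevantSMul k n (F.gen p →₀ Poly k n) :=
  (mem_irrelevantSMul_iff y).symm

theorem reduce_single_one {p : ℕ} (b : F.gen (p + 1)) :
    F.reduce p (F.d p (Finsupp.single b 1)) = F.dBar p (F.reduce (p + 1) (Finsupp.single b 1)) := by
  have h : F.reduce (p + 1) (Finsupp.single b 1) = (Finsupp.single b 1 : F.gen (p + 1) →₀ k) := by
    classical
    refine Finsupp.ext (M := k) fun c => ?_
    change MvPolynomial.constantCoeff ((Finsupp.single b (1 : Poly k n)) c) =
      (Finsupp.single b (1 : k)) c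
    rw [Finsupp.single_apply, Finsupp.single_apply]
    split_ifs <;> simp
  rw [h]
  refine Eq.trans ?_ (Finsupp.linearCombination_single k (1 : k) b).symm
  exact (one_smul k (F.reduce p (F.d p (Finsupp.single b 1)))).symm

theorem reduce_d (p : ℕ) (y : F.gen (p + 1) →₀ Poly k n) :
    F.reduce p (F.d p y) = F.dBar p (F.reduce (p + 1) y) := by
  induction y using Finsupp.induction_linear with
  | zero => simp only [map_zero]
  | add y z hy hz => rw [map_add, map_add, hy, hz, map_add, map_add]
  | single b f =>
    have h : (Finsupp.single b f : F.gen (p + 1) →₀ Poly k n) = f • Finsupp.single b 1 := by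
      rw [Finsupp.smul_single, smul_eq_mul, mul_one]
    rw [h, map_smul, reduce_smul, reduce_smul, map_smul, reduce_single_one]

theorem reduce_surjective (p : ℕ) : Function.Surjective (F.reduce p) := by
  intro u
  refine ⟨Finsupp.mapRange MvPolynomial.C (map_zero _) u, ?_⟩
  refine Finsupp.ext (M := k) fun b => ?_
  exact MvPolynomial.constantCoeff_C (Fin (n + 1)) _

theorem reduce_mem_range_dBar_iff (p : ℕ) (y : F.gen p →₀ Poly k n) :
    F.reduce p y ∈ LinearMap.range (F.dBar p) ↔
      y ∈ LinearMap.range (F.d p) ⊔ irrelevantSMul k n (F.gen p →₀ Poly k n) := by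
  constructor
  · rintro ⟨u, hu⟩
    obtain ⟨z, rfl⟩ := F.reduce_surjective _ u
    refine Submodule.mem_sup.2 ⟨_, ⟨z, rfl⟩, y - F.d p z, ?_, by abel⟩
    rw [← reduce_eq_zero_iff, map_sub, reduce_d, hu, sub_self]
  · intro h
    obtain ⟨_, ⟨z, rfl⟩, w, hw, rfl⟩ := Submodule.mem_sup.1 h
    rw [← reduce_eq_zero_iff] at hw
    exact ⟨F.reduce _ z, by rw [map_add, hw, reduce_d, add_zero]⟩

theorem torMk_mem_torDegree {p : ℕ} {m : ℤ} {y : F.gen p →₀ Poly k n}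
    (hy : y ∈ freeDegree (k := k) (F.deg p) m) (hc : F.reduce p y ∈ F.cycles p) :
    F.torMk p ⟨F.reduce p y, hc⟩ ∈ F.torDegree p m := by
  refine ⟨⟨F.reduce p y, hc⟩, ?_, rfl⟩
  change freeReduce _ y ∈ Finsupp.supported k k {b | F.deg p b = m}
  rw [Finsupp.mem_supported]
  intro b hb
  have hb' : MvPolynomial.coeff 0 (y b) ≠ 0 := by
    have := (Finsupp.mem_support_iff (f := freeReduce _ y)).1 hb
    exact this
  have := mem_polyDegree_iff.1 (hy b) 0 hb'
  simp only [map_zero, Nat.cast_zero] at this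
  change F.deg p b = m
  omega

/-- The graph of the comparison of the Koszul cycles with `F`. -/
def zigzagGraph (p : ℕ) :
    Submodule (Poly k n) (Kos k n (Poly k n) p × (F.gen p →₀ Poly k n)) where
  carrier := {c | c.1 ∈ kosCycles I p ∧
    Zigzag p (G := fun j => F.gen j →₀ Poly k n) F.aug F.d c.1 c.2}
  zero_mem' := ⟨Submodule.zero_mem _, zigzag_zero⟩
  add_mem' ha hb := ⟨Submodule.add_mem _ ha.1 hb.1, Zigzag.add ha.2 hb.2⟩
  smul_mem' r _ ha := ⟨Submodule.smul_mem _ r ha.1, Zigzag.smul r ha.2⟩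

theorem reduce_mem_cycles {p : ℕ} (g : F.zigzagGraph p) : F.reduce p g.1.2 ∈ F.cycles p := by
  obtain ⟨⟨c, y⟩, -, h⟩ := g
  cases p with
  | zero => trivial
  | succ p =>
    change F.dBar p _ = 0
    rw [← F.reduce_d, reduce_eq_zero_iff]
    exact Zigzag.d_end_mem (G := fun j => F.gen j →₀ Poly k n) (d := F.d) h

/-- The class in `Tor_p(I, k)` of the end of a zigzag. -/
def zigzagToTor (p : ℕ) : F.zigzagGraph p →ₗ[Poly k n] F.Tor p where
  toFun g := F.torMk p ⟨F.reduce p g.1.2, F.reduce_mem_cycles g⟩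
  map_add' a b := by
    have h : (⟨F.reduce p (a + b).1.2, F.reduce_mem_cycles (a + b)⟩ : F.cycles p) =
        ⟨F.reduce p a.1.2, F.reduce_mem_cycles a⟩ + ⟨F.reduce p b.1.2, F.reduce_mem_cycles b⟩ :=
      Subtype.ext (map_add (F.reduce p) a.1.2 b.1.2)
    exact (congrArg (F.torMk p) h).trans (map_add (F.torMk p) _ _)
  map_smul' r a := by
    have h : (⟨F.reduce p (r • a).1.2, F.reduce_mem_cycles (r • a)⟩ : F.cycles p) =
        MvPolynomial.constantCoeff r • ⟨F.reduce p a.1.2, F.reduce_mem_cycles a⟩ :=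
      Subtype.ext (F.reduce_smul r a.1.2)
    exact (congrArg (F.torMk p) h).trans (F.torMk_smul r _)

theorem koszul_exact (j q : ℕ) (c : Kos k n (F.gen j →₀ Poly k n) (q + 1)) (hc : kosD q c = 0) :
    ∃ b, kosD (q + 1) b = c :=
  (freeCoordDivision k n (F.gen j)).exists_kosD_eq c hc

theorem mem_range_aug_iff (x : Poly k n) : x ∈ LinearMap.range F.aug ↔ x ∈ I := by
  rw [F.range_aug]

theorem zigzagToTor_eq_zero_iff {p : ℕ} (g : F.zigzagGraph p) :
    F.zigzagToTor p g = 0 ↔ ∃ b : Kos k n (Poly k n) (p + 1), (∀ v, b v ∈ I) ∧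
      kosD p b = g.1.1 := by
  refine (F.torMk_eq_zero_iff ⟨_, F.reduce_mem_cycles g⟩).trans ((F.reduce_mem_range_dBar_iff _ _).trans
    ((Zigzag.end_mem_iff (G := fun j => F.gen j →₀ Poly k n) (d := F.d) F.exact_succ F.exact_zero
        F.koszul_exact g.2.2).trans ?_))
  constructor
  · rintro ⟨b, hb⟩
    exact ⟨kosMap F.aug _ b, fun v => (F.mem_range_aug_iff _).1 ⟨b v, rfl⟩, hb⟩
  · rintro ⟨b, hb, e⟩
    obtain ⟨z, -, hz⟩ := exists_lift_alternating (F.aug.restrictScalars k) ⊤ b fun v => by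
      obtain ⟨y, hy⟩ := (F.mem_range_aug_iff _).2 (hb v)
      exact ⟨y, trivial, hy⟩
    refine ⟨z, ?_⟩
    rw [← e]
    congr 1
    ext v : 1
    exact hz v

theorem exists_mem_zigzagGraph {p : ℕ} (c : kosCycles I p) : ∃ y, (↑c, y) ∈ F.zigzagGraph p := by
  obtain ⟨y, -, h⟩ := exists_zigzag (G := fun j => F.gen j →₀ Poly k n) (aug := F.aug) (d := F.d)
    (W := fun _ _ => ⊤) (W' := fun _ => ⊤) (m := 0) F.exact_succ F.exact_zero
    (fun _ _ _ _ _ => trivial) (fun _ _ _ ⟨y, hy⟩ => ⟨y, trivial, hy⟩)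
    (fun _ _ _ _ ⟨y, hy⟩ => ⟨y, trivial, hy⟩)
    c.1 c.2.2 (fun _ => trivial) (fun v => (F.mem_range_aug_iff _).2 (c.2.1 v))
  exact ⟨y, c.2, h⟩

theorem exists_mem_zigzagGraph_degree {p : ℕ} {m : ℤ} (c : kosCycles I p)
    (hc : ∀ v, (c : Kos k n (Poly k n) p) v ∈ polyDegree k n m) :
    ∃ y ∈ freeDegree (k := k) (F.deg p) (m + p), (↑c, y) ∈ F.zigzagGraph p := by
  obtain ⟨y, hy, h⟩ := exists_zigzag (G := fun j => F.gen j →₀ Poly k n) (aug := F.aug) (d := F.d)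
    (W := fun j m => freeDegree (F.deg j) m) (W' := polyDegree k n) F.exact_succ F.exact_zero
    (fun j i m y hy b => by
      have := mul_mem_polyDegree (X_mem_polyDegree (k := k) i) (hy b)
      rwa [show m + 1 - F.deg j b = 1 + (m - F.deg j b) by ring])
    (fun m x hx ⟨y, hy⟩ => ⟨freeComponent (F.deg 0) m y, freeComponent_mem _ _ _, by
      rw [← polyComponent_functional (F.deg 0) F.aug 0 (fun b => by
        rw [sub_zero]
        exact F.aug_homogeneous b), hy, sub_zero, polyComponent_eq_self hx]⟩)
    (fun j m x hx ⟨y, hy⟩ => ⟨freeComponent (F.deg (j + 1)) m y, freeComponent_mem _ _ _, by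
      rw [← freeComponent_map _ (F.deg j) _ (F.d_homogeneous j), hy, freeComponent_eq_self hx]⟩)
    c.1 c.2.2 hc (fun v => (F.mem_range_aug_iff _).2 (c.2.1 v))
  exact ⟨y, hy, c.2, h⟩

/-- Every cycle of `F ⊗ k` is the end of a zigzag. -/
theorem exists_start_mem_zigzagGraph {p : ℕ} (y : F.gen p →₀ Poly k n)
    (hy : F.reduce p y ∈ F.cycles p) : ∃ c, (c, y) ∈ F.zigzagGraph p := by
  cases p with
  | zero =>
    exact ⟨AlternatingMap.constOfIsEmpty k _ (Fin 0) (F.aug y),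
      ⟨fun v => (F.mem_range_aug_iff _).1 ⟨y, rfl⟩, trivial⟩, rfl⟩
  | succ p =>
    have hy' : F.d p y ∈ irrelevantSMul k n (F.gen p →₀ Poly k n) := by
      rw [← reduce_eq_zero_iff, F.reduce_d]
      exact hy
    obtain ⟨z, hz, h⟩ := exists_zigzag_end (G := fun j => F.gen j →₀ Poly k n) (aug := F.aug)
      (d := F.d) F.exact_succ F.exact_zero F.koszul_exact y hy'
    exact ⟨_, ⟨fun v => (F.mem_range_aug_iff _).1 ⟨z v, rfl⟩, hz⟩, h⟩

/-- `Tor_p(I, k)` is the homology of the Koszul complex `I ⊗ ⋀ V*`, by the comparison of the two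
edges of the double complex `F ⊗ ⋀ V*`. -/
theorem exists_cycles_to_tor (p : ℕ) :
    ∃ β : kosCycles I p →ₗ[Poly k n] F.Tor p, Function.Surjective β ∧
      (∀ c, β c = 0 ↔ ∃ b : Kos k n (Poly k n) (p + 1), (∀ v, b v ∈ I) ∧ kosD p b = c) ∧
      ∀ (m : ℤ) (c : kosCycles I p),
        (∀ v, (c : Kos k n (Poly k n) p) v ∈ polyDegree k n m) → β c ∈ F.torDegree p (m + p) := by
  let π : F.zigzagGraph p →ₗ[Poly k n] kosCycles I p :=
    (LinearMap.fst _ _ _ ∘ₗ (F.zigzagGraph p).subtype).codRestrict _ fun g => g.2.1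
  have hπ : Function.Surjective π := fun c => by
    obtain ⟨y, h⟩ := F.exists_mem_zigzagGraph c
    exact ⟨⟨(↑c, y), h⟩, rfl⟩
  have hker : ∀ g, π g = 0 → F.zigzagToTor p g = 0 := fun g hg => by
    rw [zigzagToTor_eq_zero_iff, show g.1.1 = 0 from congrArg Subtype.val hg]
    exact ⟨0, fun _ => I.zero_mem, map_zero _⟩
  obtain ⟨β, hβ⟩ := exists_factor_of_surjective (R := Poly k n) (A := F.zigzagGraph p)
    (B := kosCycles I p) (C := F.Tor p) π hπ (F.zigzagToTor p) hker
  have hβ' : ∀ (c : kosCycles I p) (y) (h : (↑c, y) ∈ F.zigzagGraph p),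
      β c = F.zigzagToTor p ⟨(↑c, y), h⟩ := fun c y h => hβ ⟨(↑c, y), h⟩
  refine ⟨β, fun t => ?_, fun c => ?_, fun m c hc => ?_⟩
  · obtain ⟨⟨u, hu⟩, rfl⟩ := F.torMk_surjective p t
    obtain ⟨y, rfl⟩ := F.reduce_surjective _ u
    obtain ⟨c, h⟩ := F.exists_start_mem_zigzagGraph y hu
    exact ⟨⟨c, h.1⟩, hβ' _ y h⟩
  · obtain ⟨y, h⟩ := F.exists_mem_zigzagGraph c
    rw [hβ' c y h, zigzagToTor_eq_zero_iff]
  · obtain ⟨y, hy, h⟩ := F.exists_mem_zigzagGraph_degree c hc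
    rw [hβ' c y h]
    exact F.torMk_mem_torDegree hy _

end GradedFreeResolution

end Tor

/-! ### The grading of Tor and the existence of resolutions -/

section TorGrading

variable {k : Type u} [Field k] {n : ℕ}

namespace GradedFreeResolution

variable {I : Ideal (Poly k n)} (F : GradedFreeResolution I)

open Classical in
/-- The component of degree `m` of `F_p ⊗ k`. -/
def fiberComponent (p : ℕ) (m : ℤ) : F.Fiber p →ₗ[k] F.Fiber p where
  toFun u := Finsupp.filter (fun b => F.deg p b = m) (show F.gen p →₀ k from u)
  map_add' _ _ := Finsupp.filter_add
  map_smul' _ _ := Finsupp.filter_smul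

theorem fiberComponent_reduce (p : ℕ) (m : ℤ) (y : F.gen p →₀ Poly k n) :
    F.fiberComponent p m (F.reduce p y) = F.reduce p (freeComponent (F.deg p) m y) := by
  classical
  refine Finsupp.ext (M := k) fun b => ?_
  refine (Finsupp.filter_apply _ _ _).trans ?_
  change _ = MvPolynomial.coeff 0 (freeComponent (F.deg p) m y b)
  rw [freeComponent_apply, coeff_polyComponent]
  by_cases h : F.deg p b = m
  · rw [if_pos h, if_pos (by simp [h])]
    rfl
  · rw [if_neg h, if_neg (by simp; omega)]

theorem fiberComponent_mem_cycles {p : ℕ} (m : ℤ) {u : F.Fiber p} (hu : u ∈ F.cycles p) :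
    F.fiberComponent p m u ∈ F.cycles p := by
  cases p with
  | zero => trivial
  | succ p =>
    obtain ⟨y, rfl⟩ := F.reduce_surjective _ u
    have hu' : F.dBar p (F.reduce _ y) = 0 := hu
    change F.dBar p _ = 0
    rw [fiberComponent_reduce, ← reduce_d, ← freeComponent_map _ (F.deg p) _ (F.d_homogeneous p),
      ← fiberComponent_reduce, reduce_d, hu', map_zero]

theorem fiberComponent_mem_range_dBar {p : ℕ} (m : ℤ) {u : F.Fiber p}
    (hu : u ∈ LinearMap.range (F.dBar p)) :
    F.fiberComponent p m u ∈ LinearMap.range (F.dBar p) := by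
  obtain ⟨w, rfl⟩ := hu
  obtain ⟨y, rfl⟩ := F.reduce_surjective _ w
  refine ⟨F.fiberComponent _ m (F.reduce _ y), ?_⟩
  rw [fiberComponent_reduce, ← reduce_d, ← reduce_d, fiberComponent_reduce,
    ← freeComponent_map _ (F.deg p) _ (F.d_homogeneous p)]

/-- The component of degree `m` of a cycle of `F ⊗ k`. -/
def cycleComponent (p : ℕ) (m : ℤ) : F.cycles p →ₗ[k] F.cycles p :=
  (F.fiberComponent p m).restrict fun _ hu => F.fiberComponent_mem_cycles m hu

/-- The component of degree `m` of `Tor_p(I, k)`. -/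
def torComponent (p : ℕ) (m : ℤ) : F.Tor p →ₗ[k] F.Tor p :=
  (F.boundaries p).mapQ (F.boundaries p) (F.cycleComponent p m)
    fun _ hu => F.fiberComponent_mem_range_dBar m hu

theorem exists_torMk_of_mem_torDegree {p : ℕ} {m : ℤ} {t : F.Tor p} (ht : t ∈ F.torDegree p m) :
    ∃ u : F.cycles p, (∀ b, (show F.gen p →₀ k from u.1) b ≠ 0 → F.deg p b = m) ∧
      F.torMk p u = t := by
  obtain ⟨u, hu, rfl⟩ := ht
  exact ⟨u, fun b hb => (Finsupp.mem_supported k _).1 hu (Finsupp.mem_support_iff.2 hb), rfl⟩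

theorem isInternal_torDegree (p : ℕ) : DirectSum.IsInternal (F.torDegree p) := by
  classical
  refine isInternal_of_projections _ (AddMonoidHom.id _) Function.injective_id
    (fun m => (F.torComponent p m).toAddMonoidHom) (fun m t ht => ?_) (fun m m' hm t ht => ?_)
    fun t => ?_
  · obtain ⟨u, hu, rfl⟩ := F.exists_torMk_of_mem_torDegree ht
    change F.torMk p _ = F.torMk p u
    congr 1
    refine Subtype.ext (Finsupp.filter_eq_self_iff _ _ |>.2 fun b hb => hu b hb)
  · obtain ⟨u, hu, rfl⟩ := F.exists_torMk_of_mem_torDegree ht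
    change F.torMk p _ = 0
    rw [← map_zero (F.torMk p)]
    congr 1
    refine Subtype.ext (Finsupp.filter_eq_zero_iff _ _ |>.2 fun b hb => ?_)
    by_contra h
    exact hm (hb ▸ hu b h)
  · obtain ⟨⟨u, hu⟩, rfl⟩ := F.torMk_surjective p t
    obtain ⟨y, rfl⟩ := F.reduce_surjective _ u
    obtain ⟨s, hs⟩ := exists_sum_freeComponent (F.deg p) y
    have h : (⟨F.reduce p y, hu⟩ : F.cycles p) =
        ∑ m ∈ s, F.cycleComponent p m ⟨F.reduce p y, hu⟩ := by
      refine Subtype.ext ?_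
      rw [AddSubmonoidClass.coe_finsetSum]
      refine (congrArg (F.reduce p) hs.symm).trans ((map_sum _ _ _).trans ?_)
      exact Finset.sum_congr rfl fun m _ => (F.fiberComponent_reduce p m y).symm
    rw [h, map_sum]
    refine Submodule.sum_mem _ fun m _ => Submodule.mem_iSup_of_mem m ?_
    have e : F.cycleComponent p m ⟨F.reduce p y, hu⟩ =
        ⟨F.reduce p (freeComponent (F.deg p) m y), by
          rw [← fiberComponent_reduce]
          exact F.fiberComponent_mem_cycles m hu⟩ := Subtype.ext (F.fiberComponent_reduce p m y)
    rw [e]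
    exact F.torMk_mem_torDegree (freeComponent_mem _ _ _) _

end GradedFreeResolution

variable (k n) in
/-- A graded submodule of a graded free module. -/
structure GradedSubmodule where
  /-- the basis of the free module -/
  gen : Type u
  /-- the degrees of the basis elements -/
  deg : gen → ℤ
  /-- the submodule -/
  N : Submodule (Poly k n) (gen →₀ Poly k n)
  freeComponent_mem : ∀ m, ∀ y ∈ N, freeComponent deg m y ∈ N

namespace GradedSubmodule

variable (S : GradedSubmodule k n)

/-- The free module on all homogeneous elements of the graded submodule, mapping onto it. -/
def cover : ((Σ m : ℤ, {y // y ∈ S.N ∧ y ∈ freeDegree (k := k) S.deg m}) →₀ Poly k n)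
    →ₗ[Poly k n] (S.gen →₀ Poly k n) :=
  Finsupp.linearCombination (Poly k n) fun g => g.2.1

theorem cover_single_one (b) : S.cover (Finsupp.single b 1) = b.2.1 := by
  simp [cover]

theorem range_cover : LinearMap.range S.cover = S.N := by
  apply le_antisymm
  · rintro _ ⟨y, rfl⟩
    exact Submodule.sum_mem _ fun g _ => S.N.smul_mem _ g.2.2.1
  · intro y hy
    obtain ⟨s, hs⟩ := exists_sum_freeComponent S.deg y
    rw [← hs]
    refine Submodule.sum_mem _ fun m _ => ?_
    exact ⟨_, S.cover_single_one ⟨m, _, S.freeComponent_mem m y hy, SyzForms.freeComponent_mem _ _ _⟩⟩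

/-- The graded module of relations between the homogeneous elements of a graded submodule. -/
def syzygy : GradedSubmodule k n where
  gen := Σ m : ℤ, {y // y ∈ S.N ∧ y ∈ freeDegree (k := k) S.deg m}
  deg := Sigma.fst
  N := LinearMap.ker S.cover
  freeComponent_mem m y hy := by
    rw [LinearMap.mem_ker] at hy ⊢
    rw [← freeComponent_map _ S.deg _ (fun b c => ?_), hy, map_zero]
    rw [cover_single_one]
    exact b.2.2.2 c

/-- The map from the free module containing the relations. -/
def syzygyMap : (S.syzygy.gen →₀ Poly k n) →ₗ[Poly k n] (S.gen →₀ Poly k n) := S.cover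

theorem syzygyMap_single_mem (b : S.syzygy.gen) (c : S.gen) :
    S.syzygyMap (Finsupp.single b 1) c ∈ polyDegree k n (S.syzygy.deg b - S.deg c) := by
  have h : S.syzygyMap (Finsupp.single b 1) = b.2.1 := S.cover_single_one b
  rw [h]
  exact b.2.2.2 c

theorem range_syzygyMap : LinearMap.range S.syzygyMap = S.N := S.range_cover

theorem ker_syzygyMap : LinearMap.ker S.syzygyMap = S.syzygy.N := rfl

theorem exact_syzygyMap : Function.Exact S.syzygy.syzygyMap S.syzygyMap := by
  rw [LinearMap.exact_iff, range_syzygyMap, ker_syzygyMap]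

/-- The iterated modules of relations. -/
def syzygies : ℕ → GradedSubmodule k n
  | 0 => S
  | p + 1 => (syzygies p).syzygy

/-- A homogeneous ideal as a graded submodule of the free module `R`. -/
def ofIdeal (I : Ideal (Poly k n)) (hI : ∀ m, ∀ f ∈ I, polyComponent k n m f ∈ I) :
    GradedSubmodule k n where
  gen := PUnit
  deg _ := 0
  N := Submodule.comap
    (Finsupp.lapply PUnit.unit : (PUnit.{u + 1} →₀ Poly k n) →ₗ[Poly k n] Poly k n) I
  freeComponent_mem m y hy := by
    change freeComponent _ m y _ ∈ I
    rw [freeComponent_apply]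
    exact hI _ _ hy

/-- The projection of the free module containing a homogeneous ideal to `R`. -/
def ofIdealProj (I : Ideal (Poly k n)) (hI : ∀ m, ∀ f ∈ I, polyComponent k n m f ∈ I) :
    ((ofIdeal I hI).gen →₀ Poly k n) →ₗ[Poly k n] Poly k n :=
  Finsupp.lapply PUnit.unit

theorem ofIdealProj_injective (I : Ideal (Poly k n))
    (hI : ∀ m, ∀ f ∈ I, polyComponent k n m f ∈ I) : Function.Injective (ofIdealProj I hI) :=
  fun _ _ h => Finsupp.ext fun _ => h

theorem map_ofIdealProj (I : Ideal (Poly k n)) (hI : ∀ m, ∀ f ∈ I, polyComponent k n m f ∈ I) :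
    Submodule.map (ofIdealProj I hI) (ofIdeal I hI).N = I :=
  Submodule.map_comap_eq_of_surjective
    (fun f => ⟨Finsupp.single PUnit.unit f, Finsupp.single_eq_same⟩) I

end GradedSubmodule

/-- Every homogeneous ideal has a graded free resolution. -/
theorem nonempty_gradedFreeResolution (I : Ideal (Poly k n))
    (hI : ∀ m, ∀ f ∈ I, polyComponent k n m f ∈ I) : Nonempty (GradedFreeResolution I) := by
  let S := GradedSubmodule.ofIdeal I hI
  let e := GradedSubmodule.ofIdealProj I hI
  refine ⟨{
    gen := fun p => (S.syzygies (p + 1)).gen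
    deg := fun p => (S.syzygies (p + 1)).deg
    d := fun p => (S.syzygies (p + 1)).syzygyMap
    aug := e ∘ₗ S.syzygyMap
    d_homogeneous := fun p b c => (S.syzygies (p + 1)).syzygyMap_single_mem b c
    aug_homogeneous := fun b => ?_
    range_aug := (LinearMap.range_comp S.syzygyMap e).trans ?_
    exact_zero := ?_
    exact_succ := fun p => (S.syzygies (p + 1)).exact_syzygyMap }⟩
  · have := S.syzygyMap_single_mem b PUnit.unit
    rwa [show S.deg PUnit.unit = 0 from rfl, sub_zero] at this
  · rw [GradedSubmodule.range_syzygyMap]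
    exact GradedSubmodule.map_ofIdealProj I hI
  · intro y
    refine Iff.trans ?_ (S.exact_syzygyMap y)
    exact map_eq_zero_iff e (GradedSubmodule.ofIdealProj_injective I hI)

end TorGrading

/-! ### Coefficients of exterior forms -/

section Coefficients

open Module

variable {k : Type*} [Field k] {n : ℕ} {A M : Type*} [CommRing A] [Algebra k A] [AddCommGroup M]
  [Module A M]

/-- The linear form `∑ vₗ b*ₗ` on a free module, for a vector `v` with coordinates in `k`. -/
def dualVec (b : Basis (Fin (n + 1)) A M) : ConstVec k n →ₗ[k] Dual A M where
  toFun v := ∑ l, algebraMap k A (v l) • b.coord l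
  map_add' v w := by simp [add_smul, Finset.sum_add_distrib]
  map_smul' c v := by
    simp only [Pi.smul_apply, smul_eq_mul, map_mul, mul_smul, RingHom.id_apply, Finset.smul_sum,
      algebraMap_smul]

theorem dualVec_unitVec (b : Basis (Fin (n + 1)) A M) (l : Fin (n + 1)) :
    dualVec b (unitVec k l) = b.coord l := by
  change ∑ j, algebraMap k A ((Pi.single l 1 : ConstVec k n) j) • b.coord j = _
  rw [Finset.sum_eq_single l]
  · simp
  · intro j _ hj
    simp [Pi.single_eq_of_ne hj]
  · simp

/-- The coefficients of an exterior form with respect to a basis, as the alternating form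
`v₁, …, v_p ↦ ⟨v₁ ∧ ⋯ ∧ v_p, ω⟩`. -/
def altCoeff (b : Basis (Fin (n + 1)) A M) (p : ℕ) :
    (⋀[A]^p M) →ₗ[A] (ConstVec k n) [⋀^Fin p]→ₗ[k] A where
  toFun ω :=
    { toFun := fun v =>
        exteriorPower.pairingDual A M p (exteriorPower.ιMulti A p fun j => dualVec b (v j)) ω
      map_update_add' := fun v i x y => by
        have h : ∀ z, (fun j => dualVec b (Function.update v i z j)) =
            Function.update (fun j => dualVec b (v j)) i (dualVec b z) := fun z => by
          funext j
          by_cases hj : j = i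
          · subst hj; simp
          · simp [hj]
        simp only [h, map_add, AlternatingMap.map_update_add, LinearMap.add_apply]
      map_update_smul' := fun v i c x => by
        have h : ∀ z, (fun j => dualVec b (Function.update v i z j)) =
            Function.update (fun j => dualVec b (v j)) i (dualVec b z) := fun z => by
          funext j
          by_cases hj : j = i
          · subst hj; simp
          · simp [hj]
        simp only [h, map_smul]
        rw [← algebraMap_smul A c (dualVec b x), AlternatingMap.map_update_smul, map_smul,
          LinearMap.smul_apply, algebraMap_smul]
      map_eq_zero_of_eq' := fun v i j h hij => by
        rw [(exteriorPower.ιMulti A p).map_eq_zero_of_eq (fun j => dualVec b (v j))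
          (congrArg (dualVec b) h) hij, map_zero,
          LinearMap.zero_apply] }
  map_add' x y := by
    ext v
    exact map_add (exteriorPower.pairingDual A M p
      (exteriorPower.ιMulti A p fun j => dualVec b (v j))) x y
  map_smul' a x := by
    ext v
    exact map_smul (exteriorPower.pairingDual A M p
      (exteriorPower.ιMulti A p fun j => dualVec b (v j))) a x

theorem altCoeff_ιMulti (b : Basis (Fin (n + 1)) A M) {p : ℕ} (m : Fin p → M)
    (v : Fin p → ConstVec k n) :
    altCoeff b p (exteriorPower.ιMulti A p m) v =
      Matrix.det (Matrix.of fun i j => dualVec b (v j) (m i)) :=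
  exteriorPower.pairingDual_ιMulti_ιMulti _ _

theorem altCoeff_unitVec (b : Basis (Fin (n + 1)) A M) {p : ℕ} (ω : ⋀[A]^p M)
    (s : Set.powersetCard (Fin (n + 1)) p) :
    altCoeff b p ω (fun j => unitVec k (Set.powersetCard.ofFinEmbEquiv.symm s j)) =
      (b.exteriorPower p).repr ω s := by
  rw [exteriorPower.basis_repr_apply]
  change exteriorPower.pairingDual A M p (exteriorPower.ιMulti A p
    fun j => dualVec b (unitVec k (Set.powersetCard.ofFinEmbEquiv.symm s j))) ω = _
  simp only [dualVec_unitVec]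
  rfl

theorem altCoeff_injective (b : Basis (Fin (n + 1)) A M) (p : ℕ) :
    Function.Injective (altCoeff (k := k) b p) := by
  intro x y h
  refine (b.exteriorPower p).repr.injective (Finsupp.ext fun s => ?_)
  rw [← altCoeff_unitVec (k := k), ← altCoeff_unitVec (k := k), h]

/-- An alternating form is determined by its values on the increasing tuples of basis vectors. -/
theorem kos_ext_increasing {N : Type*} [AddCommGroup N] [Module k N] {p : ℕ} {c c' : Kos k n N p}
    (h : ∀ s : Set.powersetCard (Fin (n + 1)) p,
      c (fun j => unitVec k (Set.powersetCard.ofFinEmbEquiv.symm s j)) =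
        c' fun j => unitVec k (Set.powersetCard.ofFinEmbEquiv.symm s j)) : c = c' := by
  refine (exteriorPower.alternatingMapLinearEquiv (R := k)).injective
    (((Pi.basisFun k (Fin (n + 1))).exteriorPower p).ext fun s => ?_)
  rw [exteriorPower.basis_apply, exteriorPower.ιMulti_family,
    exteriorPower.alternatingMapLinearEquiv_apply_ιMulti,
    exteriorPower.alternatingMapLinearEquiv_apply_ιMulti]
  convert h s using 2 <;> (funext j; simp)

theorem altCoeff_surjective (b : Basis (Fin (n + 1)) A M) (p : ℕ) :
    Function.Surjective (altCoeff (k := k) b p) := by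
  intro c
  refine ⟨(b.exteriorPower p).equivFun.symm fun s =>
    c fun j => unitVec k (Set.powersetCard.ofFinEmbEquiv.symm s j), kos_ext_increasing fun s => ?_⟩
  rw [altCoeff_unitVec, ← Basis.equivFun_apply, LinearEquiv.apply_symm_apply]

theorem contract_ιMulti (e : M →ₗ[A] A) {p : ℕ} (m : Fin (p + 1) → M) :
    contract e p (exteriorPower.ιMulti A (p + 1) m) =
      ∑ i : Fin (p + 1), ((-1) ^ (i : ℕ) * e (m i)) •
        exteriorPower.ιMulti A p fun j => m (i.succAbove j) := by
  ext1
  have hc : ((contract e p (exteriorPower.ιMulti A (p + 1) m) : ⋀[A]^p M) : ExteriorAlgebra A M) =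
      CliffordAlgebra.contractLeft (Q := (0 : QuadraticForm A M)) e
        (ExteriorAlgebra.ιMulti A (p + 1) m) := rfl
  rw [hc, AddSubmonoidClass.coe_finsetSum]
  simp only [Submodule.coe_smul, exteriorPower.ιMulti_apply_coe]
  clear hc
  induction p with
  | zero =>
    rw [ExteriorAlgebra.ιMulti_succ_apply, ExteriorAlgebra.ι]
    rw [CliffordAlgebra.contractLeft_ι_mul, ExteriorAlgebra.ιMulti_zero_apply,
      CliffordAlgebra.contractLeft_one, mul_zero, sub_zero]
    simp
  | succ p ih =>
    rw [ExteriorAlgebra.ιMulti_succ_apply, ExteriorAlgebra.ι]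
    rw [CliffordAlgebra.contractLeft_ι_mul, Fin.sum_univ_succ, sub_eq_add_neg]
    congr 1
    · simp
      rfl
    · have := ih (Matrix.vecTail m)
      rw [this, Finset.mul_sum, ← Finset.sum_neg_distrib]
      refine Finset.sum_congr rfl fun i _ => ?_
      rw [ExteriorAlgebra.ιMulti_succ_apply, mul_smul_comm, ← neg_smul]
      congr 1
      · simp [pow_succ, Matrix.vecTail]
      · congr 2
        funext j
        simp [Matrix.vecTail, Fin.succ_succAbove_succ]

/-- Contraction with `e` is the Koszul differential on coefficients. -/
theorem altCoeff_contract (b : Basis (Fin (n + 1)) A M) (e : M →ₗ[A] A) {p : ℕ}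
    (ω : ⋀[A]^(p + 1) M) (v : Fin p → ConstVec k n) :
    altCoeff b p (contract e p ω) v =
      ∑ l, e (b l) * altCoeff b (p + 1) ω (Matrix.vecCons (unitVec k l) v) := by
  have hω : ω ∈ Submodule.span A (Set.range (exteriorPower.ιMulti A (p + 1) (M := M))) := by
    rw [exteriorPower.ιMulti_span]
    trivial
  induction hω using Submodule.span_induction with
  | zero => simp
  | add x y _ _ hx hy =>
    simp only [map_add, AlternatingMap.add_apply, hx, hy, mul_add, Finset.sum_add_distrib]
  | smul a x _ hx =>
    simp only [map_smul, AlternatingMap.smul_apply, hx, smul_eq_mul, Finset.mul_sum]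
    exact Finset.sum_congr rfl fun i _ => mul_left_comm _ _ _
  | mem x hx =>
    obtain ⟨m, rfl⟩ := hx
    rw [contract_ιMulti, map_sum, alternatingMap_sum_apply]
    simp only [map_smul, AlternatingMap.smul_apply, altCoeff_ιMulti, Matrix.det_succ_column_zero,
      Matrix.of_apply, Matrix.vecCons, Fin.cons_zero, dualVec_unitVec, Finset.mul_sum]
    rw [Finset.sum_comm]
    refine Finset.sum_congr rfl fun i _ => ?_
    have he : e (m i) = ∑ l, e (b l) * b.coord l (m i) := by
      conv_lhs => rw [← b.sum_repr (m i), map_sum]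
      simp [mul_comm]
    rw [he, Finset.mul_sum, Finset.sum_smul]
    refine Finset.sum_congr rfl fun l _ => ?_
    have : (Matrix.of fun (i' : Fin (p + 1)) (j : Fin (p + 1)) =>
        dualVec b ((Fin.cons (unitVec k l) v : Fin (p + 1) → ConstVec k n) j) (m i')).submatrix
          i.succAbove Fin.succ =
        Matrix.of fun i' j => dualVec b (v j) (m (i.succAbove i')) := by
      ext i' j
      simp
    rw [this, smul_eq_mul]
    ring

end Coefficients

/-! ### Coefficients of Kähler forms -/

section KaehlerForms

open Module

variable {k : Type*} [CommRing k] {A B C : Type*} [CommRing A] [CommRing B] [CommRing C]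
  [Algebra k A] [Algebra k B] [Algebra k C]

theorem span_wedgeD (p : ℕ) :
    Submodule.span A {ω : Forms k A p | ∃ a : Fin p → A, ω = wedgeD k a} = ⊤ := by
  have h := exteriorPower.ιMulti_span_of_span A p (Ω[A⁄k])
    (KaehlerDifferential.span_range_derivation k A)
  refine top_le_iff.1 (h.symm.le.trans (Submodule.span_mono ?_))
  rintro _ ⟨m, hm, rfl⟩
  choose a ha using fun j => hm ⟨j, rfl⟩
  exact ⟨a, congrArg (exteriorPower.ιMulti A p) (funext fun j => (ha j).symm)⟩

/-- Induction for forms: they are sums of forms `a · da₁ ∧ ⋯ ∧ da_p`. -/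
theorem forms_induction {p : ℕ} {P : Forms k A p → Prop} (ω : Forms k A p) (zero : P 0)
    (add : ∀ x y, P x → P y → P (x + y)) (smul : ∀ (c : A) (a : Fin p → A), P (c • wedgeD k a)) :
    P ω := by
  have hω : ω ∈ Submodule.span A {ω : Forms k A p | ∃ a : Fin p → A, ω = wedgeD k a} := by
    rw [span_wedgeD]
    trivial
  refine Submodule.closure_induction (p := fun x _ => P x) zero (fun x y _ _ => add x y) ?_ hω
  rintro c _ ⟨a, rfl⟩
  exact smul c a

theorem pullback_smul (φ : A →ₐ[k] B) (p : ℕ) (a : A) (ω : Forms k A p) :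
    pullback φ p (a • ω) = φ a • pullback φ p ω :=
  (pullback φ p).map_smulₛₗ a ω

theorem pullback_comp (φ : A →ₐ[k] B) (ψ : B →ₐ[k] C) (p : ℕ) (ω : Forms k A p) :
    pullback ψ p (pullback φ p ω) = pullback (ψ.comp φ) p ω := by
  induction ω using forms_induction with
  | zero => simp only [map_zero]
  | add x y hx hy => simp only [map_add, hx, hy]
  | smul c a =>
    simp only [pullback_smul, pullback_wedgeD]
    rfl

theorem D_algHom_eq_sum {ι : Type*} [Fintype ι] (φ : A →ₐ[k] B) (b : Basis ι A (Ω[A⁄k])) (a : ι → A)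
    (hb : ∀ l, b l = KaehlerDifferential.D k A (a l)) (x : A) :
    KaehlerDifferential.D k B (φ x) =
      ∑ l, φ (b.repr (KaehlerDifferential.D k A x) l) • KaehlerDifferential.D k B (φ (a l)) := by
  let : Algebra A B := (φ : A →+* B).toAlgebra
  have : IsScalarTower k A B := .of_algebraMap_eq' φ.comp_algebraMap.symm
  have h := congrArg (KaehlerDifferential.map k k A B) (b.sum_repr (KaehlerDifferential.D k A x))
  rw [map_sum, KaehlerDifferential.map_D] at h
  refine h.symm.trans (Finset.sum_congr rfl fun l _ => ?_)
  rw [map_smul, hb, KaehlerDifferential.map_D]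
  rfl

end KaehlerForms

section KaehlerCoefficients

open Module

variable {k : Type*} [Field k] {n : ℕ} {A B : Type*} [CommRing A] [CommRing B] [Algebra k A]
  [Algebra k B]

theorem dualVec_apply {M : Type*} [AddCommGroup M] [Module A M] (b : Basis (Fin (n + 1)) A M)
    (v : ConstVec k n) (m : M) : dualVec b v m = ∑ l, algebraMap k A (v l) * b.repr m l := by
  simp [dualVec, Algebra.smul_def]

/-- The coefficients of a form with respect to a basis `(dx₀, …, dxₙ)` of the `1`-forms. -/
def coeffs (b : Basis (Fin (n + 1)) A (Ω[A⁄k])) (p : ℕ) : Forms k A p →ₗ[A] Kos k n A p :=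
  altCoeff b p

theorem coeffs_injective (b : Basis (Fin (n + 1)) A (Ω[A⁄k])) (p : ℕ) :
    Function.Injective (coeffs b p) := altCoeff_injective b p

theorem coeffs_surjective (b : Basis (Fin (n + 1)) A (Ω[A⁄k])) (p : ℕ) :
    Function.Surjective (coeffs b p) := altCoeff_surjective b p

theorem coeffs_wedgeD (b : Basis (Fin (n + 1)) A (Ω[A⁄k])) {p : ℕ} (a : Fin p → A)
    (v : Fin p → ConstVec k n) : coeffs b p (wedgeD k a) v =
      Matrix.det (Matrix.of fun i j => dualVec b (v j) (KaehlerDifferential.D k A (a i))) :=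
  altCoeff_ιMulti b _ v

theorem coeffs_pullback (φ : A →ₐ[k] B) (bA : Basis (Fin (n + 1)) A (Ω[A⁄k]))
    (bB : Basis (Fin (n + 1)) B (Ω[B⁄k])) (x : Fin (n + 1) → A)
    (hA : ∀ l, bA l = KaehlerDifferential.D k A (x l))
    (hB : ∀ l, bB l = KaehlerDifferential.D k B (φ (x l))) {p : ℕ} (ω : Forms k A p)
    (v : Fin p → ConstVec k n) : coeffs bB p (pullback φ p ω) v = φ (coeffs bA p ω v) := by
  induction ω using forms_induction with
  | zero => simp
  | add x y hx hy => simp only [map_add, AlternatingMap.add_apply, hx, hy]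
  | smul c a =>
    rw [pullback_smul, map_smul, map_smul, AlternatingMap.smul_apply, AlternatingMap.smul_apply,
      smul_eq_mul, smul_eq_mul, map_mul, pullback_wedgeD, coeffs_wedgeD, coeffs_wedgeD,
      AlgHom.map_det]
    congr 2
    ext i j
    have hD : ∀ l, bB.repr (KaehlerDifferential.D k B (φ (a i))) l =
        φ (bA.repr (KaehlerDifferential.D k A (a i)) l) := fun l => by
      rw [D_algHom_eq_sum φ bA x hA]
      simp only [← hB, Basis.repr_sum_self]
    simp only [Matrix.of_apply, AlgHom.mapMatrix_apply, Matrix.map_apply, dualVec_apply, hD,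
      map_sum, map_mul, AlgHom.commutes]

end KaehlerCoefficients

section Localization

open Module

variable {k : Type*} [Field k] {n : ℕ}

variable (k n) in
/-- The basis `dx₀, …, dxₙ` of `Ω_R^1`. -/
def polyBasis : Basis (Fin (n + 1)) (MvPolynomial (Fin (n + 1)) k)
    (Ω[MvPolynomial (Fin (n + 1)) k⁄k]) :=
  KaehlerDifferential.mvPolynomialBasis k (Fin (n + 1))

theorem polyBasis_apply (l : Fin (n + 1)) :
    polyBasis k n l = KaehlerDifferential.D k _ (MvPolynomial.X l) :=
  KaehlerDifferential.mvPolynomialBasis_apply k _ l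

variable (S : Type*) [CommRing S] [Algebra k S] [Algebra (MvPolynomial (Fin (n + 1)) k) S]
  [IsScalarTower k (MvPolynomial (Fin (n + 1)) k) S] (W : Submonoid (MvPolynomial (Fin (n + 1)) k))
  [IsLocalization W S]

/-- The basis `dx₀, …, dxₙ` of the differentials of a localization of `R`. -/
def locBasis : Basis (Fin (n + 1)) S (Ω[S⁄k]) :=
  (polyBasis k n).ofIsLocalizedModule S W
    (KaehlerDifferential.map k k (MvPolynomial (Fin (n + 1)) k) S)

theorem locBasis_apply (l : Fin (n + 1)) : locBasis S W l =
    KaehlerDifferential.D k S (algebraMap (MvPolynomial (Fin (n + 1)) k) S (MvPolynomial.X l)) := by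
  rw [locBasis, Basis.ofIsLocalizedModule_apply, polyBasis_apply, KaehlerDifferential.map_D]

end Localization

/-! ### Charts and dehomogenization -/

section Charts

open Module

variable {k : Type u} [Field k] {n : ℕ}

theorem coord_mem_grading (l : Fin (n + 1)) : (coord l : Poly k n) ∈ grading k n 1 :=
  MvPolynomial.isHomogeneous_X k l

/-- The dehomogenization `x_l ↦ x_l / xᵢ`. -/
def dehom (i : Fin (n + 1)) : Poly k n →ₐ[k] Chart k i :=
  MvPolynomial.aeval fun l => HomogeneousLocalization.Away.mk (grading k n)
    (coord_mem_grading i) 1 (coord l) (coord_mem_grading l)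

theorem polyToCone_coord (i : Fin (n + 1)) :
    polyToCone i (coord i) = ((coordUnit i : (Cone k i)ˣ) : Cone k i) := rfl

theorem chartToCone_injective (i : Fin (n + 1)) : Function.Injective (chartToCone (k := k) i) :=
  HomogeneousLocalization.val_injective _

theorem coord_mul_chartToCone_dehom (i l : Fin (n + 1)) :
    polyToCone i (coord i) * chartToCone i (dehom (k := k) i (coord l)) =
      polyToCone i (coord l) := by
  rw [dehom, MvPolynomial.aeval_X]
  change algebraMap (Poly k n) (Cone k i) (coord i) * Localization.mk (coord l) _ =
    algebraMap (Poly k n) (Cone k i) (coord l)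
  rw [← Localization.mk_one_eq_algebraMap, ← Localization.mk_one_eq_algebraMap, Localization.mk_mul,
    Localization.mk_eq_mk_iff, Localization.r_iff_exists]
  exact ⟨1, by simp⟩

/-- A homogeneous polynomial of degree `m` is `xᵢᵐ` times its dehomogenization. -/
theorem polyToCone_eq (i : Fin (n + 1)) {m : ℕ} {f : Poly k n} (hf : f ∈ grading k n m) :
    polyToCone i f = polyToCone i (coord i) ^ m * chartToCone i (dehom i f) := by
  have h1 : ∀ φ : Poly k n →ₐ[k] Cone k i, φ f =
      ∑ s ∈ f.support, algebraMap k _ (f.coeff s) * ∏ l, φ (coord l) ^ s l := fun φ => by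
    conv_lhs => rw [MvPolynomial.aeval_unique φ, MvPolynomial.aeval_def, MvPolynomial.eval₂_eq']
    rfl
  rw [h1 (polyToCone i)]
  refine Eq.trans ?_ (congrArg _ (h1 ((chartToCone i).comp (dehom i))).symm)
  rw [Finset.mul_sum]
  refine Finset.sum_congr rfl fun s hs => ?_
  have hm : m = ∑ l, s l := by
    have := mem_polyDegree_iff.1 (mem_polyDegree_natCast.2 hf) s (MvPolynomial.mem_support_iff.1 hs)
    rw [Finsupp.degree_eq_sum] at this
    exact_mod_cast this.symm
  rw [hm, ← Finset.prod_pow_eq_pow_sum, mul_left_comm, ← Finset.prod_mul_distrib]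
  congr 1
  refine Finset.prod_congr rfl fun l _ => ?_
  rw [AlgHom.comp_apply, ← mul_pow, coord_mul_chartToCone_dehom]

/-- An element of the chart, times a power of `xᵢ`, is a homogeneous polynomial. -/
theorem exists_coord_pow_mul_chartToCone (i : Fin (n + 1)) (y : Chart k i) :
    ∃ (m : ℕ) (f : Poly k n), f ∈ grading k n m ∧
      polyToCone i (coord i) ^ m * chartToCone i y = polyToCone i f := by
  obtain ⟨m, f, hf, rfl⟩ := HomogeneousLocalization.Away.mk_surjective (grading k n)
    (coord_mem_grading i) y
  refine ⟨m, f, by simpa using hf, ?_⟩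
  change algebraMap (Poly k n) (Cone k i) (coord i) ^ m * Localization.mk f _ =
    algebraMap (Poly k n) (Cone k i) f
  rw [← map_pow, ← Localization.mk_one_eq_algebraMap, ← Localization.mk_one_eq_algebraMap,
    Localization.mk_mul, Localization.mk_eq_mk_iff, Localization.r_iff_exists]
  exact ⟨1, by simp⟩

theorem isUnit_polyToCone_coord (i : Fin (n + 1)) : IsUnit (polyToCone (k := k) i (coord i)) :=
  (coordUnit i).isUnit

theorem dehom_surjective (i : Fin (n + 1)) : Function.Surjective (dehom (k := k) i) := by
  intro y
  obtain ⟨m, f, hf, h⟩ := exists_coord_pow_mul_chartToCone i y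
  refine ⟨f, chartToCone_injective i (((isUnit_polyToCone_coord i).pow m).mul_left_cancel ?_)⟩
  rw [h, polyToCone_eq i hf]

theorem polyToCone_injective (i : Fin (n + 1)) : Function.Injective (polyToCone (k := k) i) :=
  IsLocalization.injective (Cone k i) (M := Submonoid.powers (coord i : Poly k n))
    (powers_le_nonZeroDivisors_of_noZeroDivisors (MvPolynomial.X_ne_zero i))

theorem coneToOverlapLeft_polyToCone (i j : Fin (n + 1)) (f : Poly k n) :
    coneToOverlapLeft i j (polyToCone i f) = algebraMap (Poly k n) (Overlap k i j) f :=
  IsLocalization.lift_eq _ f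

theorem coneToOverlapRight_polyToCone (i j : Fin (n + 1)) (f : Poly k n) :
    coneToOverlapRight i j (polyToCone j f) = algebraMap (Poly k n) (Overlap k i j) f :=
  IsLocalization.lift_eq _ f

theorem algebraMap_overlap_injective (i j : Fin (n + 1)) :
    Function.Injective (algebraMap (Poly k n) (Overlap k i j)) :=
  IsLocalization.injective _ (M := Submonoid.powers (coord i * coord j : Poly k n))
    (powers_le_nonZeroDivisors_of_noZeroDivisors
      (mul_ne_zero (MvPolynomial.X_ne_zero i) (MvPolynomial.X_ne_zero j)))

theorem restrictForm_compatible (p : ℕ) (ω : Forms k (Poly k n) p) (i j : Fin (n + 1)) :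
    pullback (coneToOverlapLeft i j) p (restrictForm p ω i) =
      pullback (coneToOverlapRight i j) p (restrictForm p ω j) := by
  have h : (coneToOverlapLeft i j).comp (polyToCone i) =
      (coneToOverlapRight (k := k) i j).comp (polyToCone j) := AlgHom.ext fun f => by
    rw [AlgHom.comp_apply, AlgHom.comp_apply, coneToOverlapLeft_polyToCone,
      coneToOverlapRight_polyToCone]
  rw [restrictForm, restrictForm, pullback_comp, pullback_comp, h]

variable (k) in
/-- The basis `dx₀, …, dxₙ` of the differentials of `R_{xᵢ}`. -/
def coneBasis (i : Fin (n + 1)) : Basis (Fin (n + 1)) (Cone k i) (Ω[Cone k i⁄k]) :=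
  locBasis (Cone k i) (Submonoid.powers (coord i))

theorem coneBasis_apply (i l : Fin (n + 1)) :
    coneBasis k i l = KaehlerDifferential.D k _ (polyToCone i (coord l)) :=
  locBasis_apply _ _ l

variable (k) in
/-- The basis `dx₀, …, dxₙ` of the differentials of `R_{xᵢxⱼ}`. -/
def overlapBasis (i j : Fin (n + 1)) :
    Basis (Fin (n + 1)) (Overlap k i j) (Ω[Overlap k i j⁄k]) :=
  locBasis (Overlap k i j) (Submonoid.powers (coord i * coord j))

theorem coeffs_restrictForm {p : ℕ} (ω : Forms k (Poly k n) p) (i : Fin (n + 1))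
    (v : Fin p → ConstVec k n) :
    coeffs (coneBasis k i) p (restrictForm p ω i) v =
      polyToCone i (coeffs (polyBasis k n) p ω v) :=
  coeffs_pullback _ _ _ _ polyBasis_apply (coneBasis_apply i) ω v

theorem coeffs_coneToOverlapLeft {p : ℕ} (i j : Fin (n + 1)) (ω : Forms k (Cone k i) p)
    (v : Fin p → ConstVec k n) :
    coeffs (overlapBasis k i j) p (pullback (coneToOverlapLeft i j) p ω) v =
      coneToOverlapLeft i j (coeffs (coneBasis k i) p ω v) :=
  coeffs_pullback _ _ _ _ (coneBasis_apply i) (fun l => by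
    rw [coneToOverlapLeft_polyToCone]; exact locBasis_apply _ _ l) ω v

theorem coeffs_coneToOverlapRight {p : ℕ} (i j : Fin (n + 1)) (ω : Forms k (Cone k j) p)
    (v : Fin p → ConstVec k n) :
    coeffs (overlapBasis k i j) p (pullback (coneToOverlapRight i j) p ω) v =
      coneToOverlapRight i j (coeffs (coneBasis k j) p ω v) :=
  coeffs_pullback _ _ _ _ (coneBasis_apply j) (fun l => by
    rw [coneToOverlapRight_polyToCone]; exact locBasis_apply _ _ l) ω v

/-- Functions on the open sets `{xᵢ ≠ 0}` of `𝔸ⁿ⁺¹ ∖ {0}` which agree on the overlaps come from a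
polynomial, as `n ≥ 1`. -/
theorem exists_polyToCone_eq (hn : 1 ≤ n) (g : ∀ i : Fin (n + 1), Cone k i)
    (hg : ∀ i j, coneToOverlapLeft i j (g i) = coneToOverlapRight i j (g j)) :
    ∃ f : Poly k n, ∀ i, polyToCone i f = g i := by
  have hfrac : ∀ i, ∃ (a : ℕ) (f : Poly k n), g i * polyToCone i (coord i) ^ a = polyToCone i f := by
    intro i
    obtain ⟨a, f, h⟩ := IsLocalization.Away.surj (coord i : Poly k n) (g i)
    exact ⟨a, f, h⟩
  -- fractions which agree on an overlap agree after clearing denominators in `R`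
  have hcross : ∀ i j a b f h, g i * polyToCone i (coord i) ^ a = polyToCone i f →
      g j * polyToCone j (coord j) ^ b = polyToCone j h →
      f * coord j ^ b = h * coord i ^ a := by
    intro i j a b f h hf hh
    apply algebraMap_overlap_injective i j
    have h1 := congrArg (coneToOverlapLeft i j) hf
    have h2 := congrArg (coneToOverlapRight i j) hh
    rw [map_mul, map_pow, coneToOverlapLeft_polyToCone, coneToOverlapLeft_polyToCone] at h1
    rw [map_mul, map_pow, coneToOverlapRight_polyToCone, coneToOverlapRight_polyToCone, ← hg] at h2
    rw [map_mul, map_mul, map_pow, map_pow, ← h1, ← h2]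
    ring
  obtain ⟨a, F, hF⟩ := hfrac 0
  let e : Fin (n + 1) := ⟨1, by omega⟩
  have he : e ≠ 0 := by
    intro h
    have := congrArg Fin.val h
    simp [e] at this
  -- the denominator `x₀ᵃ` cancels: it divides `x₁ᵇ F`, and `x₀` is prime to `x₁`
  have hdvd : (coord 0 : Poly k n) ^ a ∣ F := by
    obtain ⟨b, G, hG⟩ := hfrac e
    have h := hcross 0 e a b F G hF hG
    refine (MvPolynomial.X_prime (R := k) (i := (0 : Fin (n + 1)))).pow_dvd_of_dvd_mul_right a
      (b := (coord e : Poly k n) ^ b) ?_ ⟨G, ?_⟩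
    · intro hd
      have := (MvPolynomial.X_prime (R := k) (i := (0 : Fin (n + 1)))).dvd_of_dvd_pow hd
      rw [MvPolynomial.X_dvd_X] at this
      simp_all
    · rw [h, mul_comm]
  obtain ⟨f, rfl⟩ := hdvd
  have hf0 : g 0 * polyToCone 0 (coord 0) ^ 0 = polyToCone 0 f := by
    apply ((isUnit_polyToCone_coord (k := k) (n := n) 0).pow a).mul_right_cancel
    rw [pow_zero, mul_one, hF, map_mul, map_pow, mul_comm]
  refine ⟨f, fun j => ?_⟩
  obtain ⟨b, G, hG⟩ := hfrac j
  have h := hcross 0 j 0 b f G hf0 hG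
  rw [pow_zero, mul_one] at h
  apply ((isUnit_polyToCone_coord (k := k) j).pow b).mul_right_cancel
  rw [hG, ← h, map_mul, map_pow]

/-- A polynomial which is `xᵢᵐ` times a function on a chart is homogeneous of degree `m`. -/
theorem mem_polyDegree_of_polyToCone_eq (i : Fin (n + 1)) {m : ℤ} {f : Poly k n} {y : Chart k i}
    (h : polyToCone i f = ((coordUnit i ^ m : (Cone k i)ˣ) : Cone k i) * chartToCone i y) :
    f ∈ polyDegree k n m := by
  obtain ⟨a, g, hg, hy⟩ := exists_coord_pow_mul_chartToCone i y
  have hX : ∀ b : ℕ, (coord i : Poly k n) ^ b ∈ polyDegree k n b := fun b =>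
    mem_polyDegree_natCast.2 (by simpa using MvPolynomial.isHomogeneous_X_pow (R := k) i b)
  have hm : coordUnit (k := k) i ^ m * coordUnit i ^ (-m).toNat = coordUnit i ^ m.toNat := by
    rw [← zpow_natCast, ← zpow_natCast, ← zpow_add]
    congr 1
    omega
  have hm' := congrArg Units.val hm
  rw [Units.val_mul, Units.val_pow_eq_pow_val, Units.val_pow_eq_pow_val, ← polyToCone_coord] at hm'
  have key : f * coord i ^ (a + (-m).toNat) = g * coord i ^ m.toNat := by
    apply polyToCone_injective i
    rw [map_mul, map_mul, map_pow, map_pow, ← hy, h, ← hm']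
    ring
  have hdeg : f * coord i ^ (a + (-m).toNat) ∈ polyDegree k n (a + m.toNat) := by
    rw [key]
    exact mul_mem_polyDegree (mem_polyDegree_natCast.2 hg) (hX _)
  have h2 := polyComponent_mul (m := a + m.toNat) f (hX (a + (-m).toNat))
  rw [polyComponent_eq_self hdeg] at h2
  have h3 := mul_right_cancel₀ (pow_ne_zero _ (MvPolynomial.X_ne_zero i)) h2
  have h4 := polyComponent_mem ((a + m.toNat : ℤ) - ((a + (-m).toNat : ℕ) : ℤ)) f
  rw [← h3] at h4
  convert h4 using 2
  omega

end Charts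

/-! ### Contraction with the Euler field -/

section ContractForms

open Module

variable {k : Type*} [Field k] {n : ℕ} {A : Type*} [CommRing A] [Algebra k A]

/-- Contraction of forms with a linear form on the `1`-forms, i.e. with a derivation of `A`. -/
def contractForms (e : (Ω[A⁄k]) →ₗ[A] A) (p : ℕ) : Forms k A (p + 1) →ₗ[A] Forms k A p :=
  contract e p

theorem contractForms_wedgeD (e : (Ω[A⁄k]) →ₗ[A] A) {p : ℕ} (a : Fin (p + 1) → A) :
    contractForms e p (wedgeD k a) =
      ∑ i : Fin (p + 1), ((-1) ^ (i : ℕ) * e (KaehlerDifferential.D k A (a i))) •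
        wedgeD k fun j => a (i.succAbove j) :=
  contract_ιMulti e _

theorem coeffs_contractForms (b : Basis (Fin (n + 1)) A (Ω[A⁄k])) (e : (Ω[A⁄k]) →ₗ[A] A) {p : ℕ}
    (ω : Forms k A (p + 1)) (v : Fin p → ConstVec k n) :
    coeffs b p (contractForms e p ω) v =
      ∑ l, e (b l) * coeffs b (p + 1) ω (Matrix.vecCons (unitVec k l) v) :=
  altCoeff_contract b e ω v

variable (k A) in
/-- The inclusion of the `p`-forms into the exterior algebra of the `1`-forms. -/
def toExterior (p : ℕ) : Forms k A p →ₗ[A] ExteriorAlgebra A (Ω[A⁄k]) :=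
  (⋀[A]^p (Ω[A⁄k])).subtype

theorem toExterior_injective (p : ℕ) : Function.Injective (toExterior k A p) :=
  Subtype.val_injective

theorem toExterior_wedgeD {p : ℕ} (a : Fin p → A) : toExterior k A p (wedgeD k a) =
    ExteriorAlgebra.ιMulti A p fun j => KaehlerDifferential.D k A (a j) := rfl

theorem contractLeft_toExterior (e : (Ω[A⁄k]) →ₗ[A] A) {p : ℕ} (ω : Forms k A (p + 1)) :
    CliffordAlgebra.contractLeft (Q := (0 : QuadraticForm A (Ω[A⁄k]))) e (toExterior k A (p + 1) ω) =
      toExterior k A p (contractForms e p ω) := rfl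

theorem contractLeft_toExterior_zero (e : (Ω[A⁄k]) →ₗ[A] A) (ω : Forms k A 0) :
    CliffordAlgebra.contractLeft (Q := (0 : QuadraticForm A (Ω[A⁄k]))) e (toExterior k A 0 ω) = 0 := by
  have h : toExterior k A 0 ω ∈ LinearMap.range (ExteriorAlgebra.ι A (M := Ω[A⁄k])) ^ 0 :=
    Subtype.property (p := fun x => x ∈ ⋀[A]^0 (Ω[A⁄k])) ω
  rw [pow_zero] at h
  obtain ⟨a, ha⟩ := Submodule.mem_one.1 h
  rw [← ha]
  exact CliffordAlgebra.contractLeft_algebraMap (Q := (0 : QuadraticForm A (Ω[A⁄k]))) e a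

/-- A form killed by contraction with `e` is determined by its product with a `1`-form `θ` for which
`e(θ)` is a unit. -/
theorem eq_zero_of_contractLeft_eq_zero {p : ℕ} (e : (Ω[A⁄k]) →ₗ[A] A) (θ : Ω[A⁄k])
    (he : IsUnit (e θ)) (ω : Forms k A p)
    (h : CliffordAlgebra.contractLeft (Q := (0 : QuadraticForm A (Ω[A⁄k]))) e
      (toExterior k A p ω) = 0)
    (hθ : ExteriorAlgebra.ι A θ * toExterior k A p ω = 0) : ω = 0 := by
  have h1 := CliffordAlgebra.contractLeft_ι_mul (Q := (0 : QuadraticForm A (Ω[A⁄k]))) e θ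
    (toExterior k A p ω)
  rw [h, mul_zero, sub_zero] at h1
  have h2 : e θ • toExterior k A p ω = 0 := by
    rw [← h1, show CliffordAlgebra.ι (0 : QuadraticForm A (Ω[A⁄k])) θ * toExterior k A p ω = 0
      from hθ, map_zero]
  rw [← map_smul] at h2
  have h3 := toExterior_injective p (h2.trans (map_zero _).symm)
  exact he.smul_eq_zero.1 h3

end ContractForms

/-- Modulo `θ`, a product of vectors `r uⱼ + cⱼ θ` is `r^p` times the product of the `uⱼ`. -/
theorem ι_mul_ιMulti_eq {A M : Type*} [CommRing A] [AddCommGroup M] [Module A M] (θ : M) (r : A) :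
    ∀ {p : ℕ} (m u : Fin p → M) (c : Fin p → A), (∀ j, m j = r • u j + c j • θ) →
      ExteriorAlgebra.ι A θ * ExteriorAlgebra.ιMulti A p m =
        r ^ p • (ExteriorAlgebra.ι A θ * ExteriorAlgebra.ιMulti A p u) := by
  intro p
  induction p with
  | zero =>
    intro m u c _
    rw [pow_zero, one_smul, ExteriorAlgebra.ιMulti_zero_apply, ExteriorAlgebra.ιMulti_zero_apply]
  | succ p ih =>
    intro m u c h
    have hsw : ∀ y : M, ExteriorAlgebra.ι A θ * ExteriorAlgebra.ι A y =
        -(ExteriorAlgebra.ι A y * ExteriorAlgebra.ι A θ) := fun y =>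
      eq_neg_of_add_eq_zero_left (ExteriorAlgebra.ι_add_mul_swap θ y)
    have h0 : ExteriorAlgebra.ι A θ * ExteriorAlgebra.ι A (m 0) =
        r • (ExteriorAlgebra.ι A θ * ExteriorAlgebra.ι A (u 0)) := by
      rw [h 0, map_add, map_smul, map_smul, mul_add, mul_smul_comm, mul_smul_comm,
        ExteriorAlgebra.ι_sq_zero, smul_zero, add_zero]
    rw [ExteriorAlgebra.ιMulti_succ_apply, ExteriorAlgebra.ιMulti_succ_apply, ← mul_assoc, h0,
      ← mul_assoc, hsw, smul_mul_assoc, neg_mul, neg_mul, mul_assoc, mul_assoc,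
      ih (Matrix.vecTail m) (Matrix.vecTail u) (Matrix.vecTail c) fun j => h j.succ, mul_smul_comm,
      pow_succ', mul_smul, smul_neg, smul_neg, smul_neg]

section Euler

open Module

variable {k : Type u} [Field k] {n : ℕ}

/-- The identity `dx_l = xᵢ d(x_l / xᵢ) + (x_l / xᵢ) dxᵢ`. -/
theorem coordinate_differential (i l : Fin (n + 1)) :
    KaehlerDifferential.D k (Cone k i) (polyToCone i (coord l)) =
      polyToCone (k := k) i (coord i) •
          KaehlerDifferential.D k (Cone k i) (chartToCone i (dehom (k := k) i (coord l))) +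
        chartToCone i (dehom (k := k) i (coord l)) •
          KaehlerDifferential.D k (Cone k i) (polyToCone i (coord i)) := by
  rw [← coord_mul_chartToCone_dehom, Derivation.leibniz]

variable (k) in
/-- The contraction of `1`-forms on `{xᵢ ≠ 0}` with the radial vector field. -/
def coneRadial (i : Fin (n + 1)) : (Ω[Cone k i⁄k]) →ₗ[Cone k i] Cone k i :=
  (coneBasis k i).constr (Cone k i) fun l => polyToCone i (coord l)

theorem coneRadial_D_coord (i l : Fin (n + 1)) :
    coneRadial k i (KaehlerDifferential.D k (Cone k i) (polyToCone i (coord l))) =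
      polyToCone i (coord l) := by
  rw [← coneBasis_apply, coneRadial, Basis.constr_basis]

/-- The differentials of functions on the chart, written in terms of `d(x_l / xᵢ)`. -/
theorem D_chartToCone (i : Fin (n + 1)) (y : Chart k i) : ∃ c : Fin (n + 1) → Chart k i,
    KaehlerDifferential.D k (Cone k i) (chartToCone i y) =
      ∑ l, chartToCone i (c l) •
        KaehlerDifferential.D k (Cone k i) (chartToCone i (dehom (k := k) i (coord l))) := by
  obtain ⟨f, rfl⟩ := dehom_surjective i y
  exact ⟨_, D_algHom_eq_sum ((chartToCone i).comp (dehom i)) (polyBasis k n) _ polyBasis_apply f⟩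

/-- The radial vector field annihilates functions of degree `0`. -/
theorem coneRadial_D_chartToCone (i : Fin (n + 1)) (y : Chart k i) :
    coneRadial k i (KaehlerDifferential.D k (Cone k i) (chartToCone i y)) = 0 := by
  obtain ⟨c, hc⟩ := D_chartToCone i y
  rw [hc, map_sum]
  refine Finset.sum_eq_zero fun l _ => ?_
  have h := congrArg (coneRadial k i) (coordinate_differential i l)
  rw [map_add, map_smul, map_smul, coneRadial_D_coord, coneRadial_D_coord, smul_eq_mul, smul_eq_mul,
    mul_comm (chartToCone i _), coord_mul_chartToCone_dehom, right_eq_add] at h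
  rw [map_smul, (isUnit_polyToCone_coord i).mul_right_eq_zero.1 h, smul_zero]

theorem contract_pullback_chartToCone (i : Fin (n + 1)) {p : ℕ} (η : Forms k (Chart k i) (p + 1)) :
    contractForms (coneRadial k i) p (pullback (chartToCone i) (p + 1) η) = 0 := by
  induction η using forms_induction with
  | zero => simp only [map_zero]
  | add x y hx hy => rw [map_add, map_add, hx, hy, add_zero]
  | smul c a =>
    rw [pullback_smul, map_smul, pullback_wedgeD, contractForms_wedgeD]
    simp only [coneRadial_D_chartToCone, mul_zero, zero_smul, Finset.sum_const_zero, smul_zero]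

theorem coeffs_contract_restrictForm (i : Fin (n + 1)) {p : ℕ} (ω : Forms k (Poly k n) (p + 1))
    (v : Fin p → ConstVec k n) :
    coeffs (coneBasis k i) p (contractForms (coneRadial k i) p (restrictForm (p + 1) ω i)) v =
      polyToCone i (kosD p (coeffs (polyBasis k n) (p + 1) ω) v) := by
  rw [coeffs_contractForms, kosD_apply, map_sum]
  refine Finset.sum_congr rfl fun l _ => ?_
  rw [coneBasis_apply, coneRadial_D_coord, coeffs_restrictForm, smul_eq_mul, map_mul]

/-- The coefficients of the polynomial form are a Koszul cycle if the form is a multiple of the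
pullback of a form on a chart. -/
theorem kosCycle_of_restrictForm_eq (i : Fin (n + 1)) {p : ℕ} (ω : Forms k (Poly k n) p)
    (u : Cone k i) (η : Forms k (Chart k i) p)
    (h : restrictForm p ω i = u • pullback (chartToCone i) p η) :
    KosCycle (coeffs (polyBasis k n) p ω) := by
  cases p with
  | zero => trivial
  | succ p =>
    refine AlternatingMap.ext fun v => polyToCone_injective i ?_
    rw [← coeffs_contract_restrictForm, h, map_smul, contract_pullback_chartToCone, smul_zero,
      map_zero]
    simp

theorem forms_eq_sum {p : ℕ} (ω : Forms k (Poly k n) p) :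
    ω = ∑ s : Set.powersetCard (Fin (n + 1)) p,
      coeffs (polyBasis k n) p ω (fun j => unitVec k (Set.powersetCard.ofFinEmbEquiv.symm s j)) •
        wedgeD k fun j => coord (Set.powersetCard.ofFinEmbEquiv.symm s j) := by
  refine (((polyBasis k n).exteriorPower p).sum_repr ω).symm.trans
    (Finset.sum_congr rfl fun s _ => ?_)
  have h := altCoeff_unitVec (k := k) (polyBasis k n) ω s
  have h1 : (polyBasis k n).exteriorPower p s =
      (wedgeD k fun j => coord (Set.powersetCard.ofFinEmbEquiv.symm s j) :
        Forms k (Poly k n) p) := by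
    rw [exteriorPower.basis_apply, exteriorPower.ιMulti_family]
    exact congrArg (exteriorPower.ιMulti (Poly k n) p) (funext fun j => polyBasis_apply _)
  rw [← h, h1]
  rfl

/-- Modulo `dxᵢ`, a form with coefficients of degree `m` is `xᵢ^{m+p}` times the pullback of its
dehomogenization. -/
theorem D_coord_mul_restrictForm (i : Fin (n + 1)) {p m : ℕ} (ω : Forms k (Poly k n) p)
    (hω : ∀ v, coeffs (polyBasis k n) p ω v ∈ grading k n m) :
    ExteriorAlgebra.ι (Cone k i) (KaehlerDifferential.D k (Cone k i) (polyToCone i (coord i))) *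
        toExterior k (Cone k i) p (restrictForm p ω i) =
      polyToCone (k := k) i (coord i) ^ (m + p) •
        (ExteriorAlgebra.ι (Cone k i) (KaehlerDifferential.D k (Cone k i) (polyToCone i (coord i))) *
          toExterior k (Cone k i) p (pullback (chartToCone i) p (pullback (dehom i) p ω))) := by
  rw [restrictForm]
  have h := forms_eq_sum ω
  generalize hc : coeffs (polyBasis k n) p ω = c at *
  clear hc
  subst h
  simp only [map_sum, Finset.mul_sum, Finset.smul_sum]
  refine Finset.sum_congr rfl fun s _ => ?_
  rw [pullback_smul, pullback_smul, pullback_smul, pullback_wedgeD, pullback_wedgeD,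
    pullback_wedgeD, map_smul, map_smul, toExterior_wedgeD, toExterior_wedgeD, mul_smul_comm,
    mul_smul_comm, ι_mul_ιMulti_eq _ (polyToCone i (coord i)) _ _ _ fun j =>
      coordinate_differential i _, polyToCone_eq i (hω _), smul_smul, smul_smul]
  congr 1
  ring

/-- A polynomial form whose coefficients form a homogeneous Koszul cycle is, on each chart, a power
of `xᵢ` times the pullback of its dehomogenization. -/
theorem restrictForm_eq (i : Fin (n + 1)) {p m : ℕ} (ω : Forms k (Poly k n) p)
    (hω : ∀ v, coeffs (polyBasis k n) p ω v ∈ grading k n m)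
    (hc : KosCycle (coeffs (polyBasis k n) p ω)) :
    restrictForm p ω i = polyToCone (k := k) i (coord i) ^ (m + p) •
      pullback (chartToCone i) p (pullback (dehom i) p ω) := by
  refine sub_eq_zero.1 (eq_zero_of_contractLeft_eq_zero (coneRadial k i)
    (KaehlerDifferential.D k (Cone k i) (polyToCone i (coord i)))
    (by rw [coneRadial_D_coord]; exact isUnit_polyToCone_coord i) _ ?_ ?_)
  · cases p with
    | zero => exact contractLeft_toExterior_zero _ _
    | succ p =>
      rw [contractLeft_toExterior, map_sub, map_smul, contract_pullback_chartToCone, smul_zero,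
        sub_zero]
      have : contractForms (coneRadial k i) p (restrictForm (p + 1) ω i) = 0 := by
        refine coeffs_injective (coneBasis k i) p (AlternatingMap.ext fun v => ?_)
        have hc' : kosD p (coeffs (polyBasis k n) (p + 1) ω) = 0 := hc
        rw [coeffs_contract_restrictForm, hc', map_zero]
        simp
      rw [this, map_zero]
  · rw [map_sub, map_smul, mul_sub, mul_smul_comm, D_coord_mul_restrictForm i ω hω, sub_self]

/-- The coefficients of the pullback of a form on a chart with values in an ideal `J` are, up to a
power of `xᵢ`, in `J`. -/
theorem coeffs_pullback_chartToCone (i : Fin (n + 1)) {p : ℕ} (J : Ideal (Chart k i))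
    (η : Forms k (Chart k i) p)
    (hη : η ∈ J • (⊤ : Submodule (Chart k i) (Forms k (Chart k i) p))) (v : Fin p → ConstVec k n) :
    ∃ a ∈ J, polyToCone i (coord i) ^ p *
      coeffs (coneBasis k i) p (pullback (chartToCone i) p η) v = chartToCone i a := by
  have hcoord : ∀ (w : ConstVec k n) (l : Fin (n + 1)),
      dualVec (coneBasis k i) w (KaehlerDifferential.D k (Cone k i) (polyToCone i (coord l))) =
        algebraMap k _ (w l) := fun w l => by
    rw [← coneBasis_apply, dualVec_apply, Finset.sum_eq_single l]
    · simp
    · intro j _ hj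
      simp [Finsupp.single_eq_of_ne hj]
    · simp
  -- the derivative of a function of degree `0` along a constant vector field has degree `-1`
  have hD : ∀ (w : ConstVec k n) (y : Chart k i), ∃ a, polyToCone i (coord i) *
      dualVec (coneBasis k i) w (KaehlerDifferential.D k (Cone k i) (chartToCone i y)) =
        chartToCone i a := by
    intro w y
    obtain ⟨c, hc⟩ := D_chartToCone i y
    refine ⟨∑ l, c l * (algebraMap k _ (w l) - dehom i (coord l) * algebraMap k _ (w i)), ?_⟩
    rw [hc, map_sum, map_sum, Finset.mul_sum]
    refine Finset.sum_congr rfl fun l _ => ?_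
    have h := congrArg (dualVec (coneBasis k i) w) (coordinate_differential i l)
    rw [map_add, map_smul, map_smul, hcoord, hcoord, smul_eq_mul, smul_eq_mul,
      ← sub_eq_iff_eq_add] at h
    rw [map_smul, smul_eq_mul, mul_left_comm, ← h, map_mul, map_sub, map_mul, AlgHom.commutes,
      AlgHom.commutes]
  induction hη using Submodule.smul_induction_on' with
  | smul r hr η hη =>
    clear hη
    have key : ∃ a, polyToCone i (coord i) ^ p *
        coeffs (coneBasis k i) p (pullback (chartToCone i) p η) v = chartToCone i a := by
      induction η using forms_induction with
      | zero => exact ⟨0, by simp⟩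
      | add x y hx hy =>
        obtain ⟨a, ha⟩ := hx
        obtain ⟨b, hb⟩ := hy
        refine ⟨a + b, ?_⟩
        rw [map_add, map_add, map_add, AlternatingMap.add_apply, mul_add, ha, hb]
      | smul c y =>
        choose a ha using fun s t => hD (v t) (y s)
        refine ⟨c * Matrix.det (Matrix.of fun s t => a s t), ?_⟩
        rw [pullback_smul, map_smul, AlternatingMap.smul_apply, smul_eq_mul, pullback_wedgeD,
          coeffs_wedgeD, mul_left_comm, map_mul, AlgHom.map_det]
        congr 1
        have h := Matrix.det_smul (Matrix.of fun s t => dualVec (coneBasis k i) (v t)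
          (KaehlerDifferential.D k (Cone k i) (chartToCone i (y s)))) (polyToCone i (coord i))
        rw [Fintype.card_fin] at h
        rw [← h]
        congr 1
        ext s t
        exact ha s t
    obtain ⟨a, ha⟩ := key
    refine ⟨r * a, J.mul_mem_right a hr, ?_⟩
    rw [pullback_smul, map_smul, AlternatingMap.smul_apply, smul_eq_mul, mul_left_comm, ha, map_mul]
  | add x _ y _ hx hy =>
    obtain ⟨a, haJ, ha⟩ := hx
    obtain ⟨b, hbJ, hb⟩ := hy
    refine ⟨a + b, J.add_mem haJ hbJ, ?_⟩
    rw [map_add, map_add, map_add, AlternatingMap.add_apply, mul_add, ha, hb]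

end Euler

/-! ### Twisted forms as Koszul cycles -/

section TwistedForms

open Module

variable {k : Type u} [Field k] {n : ℕ} {Z : Scheme.{u}} (ι : Z ⟶ PSpace k n)

theorem polyComponent_mem_satIdeal (m : ℤ) (f : Poly k n) (hf : f ∈ satIdeal ι) :
    polyComponent k n m f ∈ satIdeal ι := by
  induction hf using Submodule.closure_induction with
  | zero => rw [map_zero]; exact zero_mem _
  | add x y _ _ hx hy => rw [map_add]; exact add_mem hx hy
  | smul_mem c x hx =>
    obtain ⟨e, he, -⟩ := id hx
    rw [smul_eq_mul, polyComponent_mul _ (mem_polyDegree_natCast.2 he)]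
    exact Ideal.mul_mem_left _ _ (Ideal.subset_span hx)

theorem dehom_mem_chartIdeal (i : Fin (n + 1)) {f : Poly k n} (hf : f ∈ satIdeal ι) :
    dehom i f ∈ chartIdeal ι i := by
  have h : satIdeal ι ≤ (chartIdeal ι i).comap (dehom i) := by
    refine Ideal.span_le.2 ?_
    rintro g ⟨m, hm, hg⟩
    obtain ⟨a, ha, h⟩ := hg i
    rw [polyToCone_eq i hm, Units.val_pow_eq_pow_val, ← polyToCone_coord] at h
    have := chartToCone_injective i (((isUnit_polyToCone_coord i).pow m).mul_left_cancel h)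
    change dehom i g ∈ chartIdeal ι i
    rwa [this]
  exact h hf

theorem mem_satIdeal_of_polyToCone_eq {m : ℤ} {f : Poly k n}
    (h : ∀ i, ∃ a ∈ chartIdeal ι i,
      polyToCone i f = ((coordUnit i ^ m : (Cone k i)ˣ) : Cone k i) * chartToCone i a) :
    f ∈ satIdeal ι ∧ f ∈ polyDegree k n m := by
  have hm : f ∈ polyDegree k n m := by
    obtain ⟨a, _, ha⟩ := h 0
    exact mem_polyDegree_of_polyToCone_eq 0 ha
  refine ⟨?_, hm⟩
  rcases lt_or_ge m 0 with h0 | h0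
  · rw [polyDegree_of_neg h0, Submodule.mem_bot] at hm
    rw [hm]
    exact zero_mem _
  · lift m to ℕ using h0
    refine Ideal.subset_span ⟨m, mem_polyDegree_natCast.1 hm, fun i => ?_⟩
    obtain ⟨a, ha, e⟩ := h i
    exact ⟨a, ha, by rw [e, zpow_natCast]⟩

/-- The sections of `Ω^p(r) ⊗ 𝓘_Z` are the polynomial forms whose coefficients are Koszul cycles
with values in the degree `r - p` part of the saturated ideal. -/
theorem mem_twistedForms_iff (hn : 1 ≤ n) {p : ℕ} {r : ℤ} {ω : ConeForms k n p} :
    ω ∈ twistedForms ι p r ↔ ∃ ζ : Forms k (Poly k n) p,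
      coeffs (polyBasis k n) p ζ ∈ kosCycles (satIdeal ι) p ∧
      (∀ v, coeffs (polyBasis k n) p ζ v ∈ polyDegree k n (r - p)) ∧ restrictForm p ζ = ω := by
  constructor
  · rintro ⟨h1, h2⟩
    choose η hη hω using h1
    choose a ha hc using fun i v => coeffs_pullback_chartToCone i (chartIdeal ι i) (η i) (hη i) v
    have hcoeff : ∀ i v, coeffs (coneBasis k i) p (ω i) v =
        ((coordUnit i ^ (r - p) : (Cone k i)ˣ) : Cone k i) * chartToCone i (a i v) := fun i v => by
      rw [hω, map_smul, AlternatingMap.smul_apply, smul_eq_mul, ← hc, ← mul_assoc,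
        polyToCone_coord, ← Units.val_pow_eq_pow_val, ← Units.val_mul, ← zpow_natCast, ← zpow_add,
        sub_add_cancel]
    let φ : Poly k n →ₗ[k] ∀ i, Cone k i := LinearMap.pi fun i => (polyToCone i).toLinearMap
    let W : Submodule k (Poly k n) := (satIdeal ι).restrictScalars k ⊓ polyDegree k n (r - p)
    obtain ⟨z, hzW, hz⟩ := exists_lift_alternating φ W
      (AlternatingMap.pi fun i => coeffs (coneBasis k i) p (ω i)) fun v => by
        obtain ⟨f, hf⟩ := exists_polyToCone_eq hn (fun i => coeffs (coneBasis k i) p (ω i) v)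
          fun i j => by rw [← coeffs_coneToOverlapLeft, ← coeffs_coneToOverlapRight, h2]
        exact ⟨f, mem_satIdeal_of_polyToCone_eq ι fun i =>
          ⟨a i v, ha i v, by rw [hf i, hcoeff]⟩, funext hf⟩
    obtain ⟨ζ, rfl⟩ := coeffs_surjective (polyBasis k n) p z
    have hζ : restrictForm p ζ = ω := by
      funext i
      refine coeffs_injective (coneBasis k i) p (AlternatingMap.ext fun v => ?_)
      rw [coeffs_restrictForm]
      exact congrFun (hz v) i
    exact ⟨ζ, ⟨fun v => (hzW v).1, kosCycle_of_restrictForm_eq 0 ζ _ (η 0) (by rw [hζ, hω])⟩,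
      fun v => (hzW v).2, hζ⟩
  · rintro ⟨ζ, ⟨hI, hcyc⟩, hdeg, rfl⟩
    refine ⟨fun i => ?_, restrictForm_compatible p ζ⟩
    rcases lt_or_ge (r - p) 0 with h0 | h0
    · have hζ : ζ = 0 := by
        refine coeffs_injective (polyBasis k n) p (AlternatingMap.ext fun v => ?_)
        have := hdeg v
        rw [polyDegree_of_neg h0, Submodule.mem_bot] at this
        rw [this, map_zero]
        simp
      subst hζ
      exact ⟨0, zero_mem _, by rw [restrictForm, map_zero, map_zero, smul_zero]⟩
    · obtain ⟨m, hm⟩ := Int.eq_ofNat_of_zero_le h0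
      have hr : r = (m + p : ℕ) := by push_cast; omega
      have hdeg' : ∀ v, coeffs (polyBasis k n) p ζ v ∈ grading k n m := fun v =>
        mem_polyDegree_natCast.1 (hm ▸ hdeg v)
      refine ⟨pullback (dehom i) p ζ, ?_, ?_⟩
      · rw [forms_eq_sum ζ, map_sum]
        refine sum_mem fun s _ => ?_
        rw [pullback_smul]
        exact Submodule.smul_mem_smul (dehom_mem_chartIdeal ι i (hI _)) trivial
      · rw [restrictForm_eq i ζ hdeg' hcyc, hr, zpow_natCast, Units.val_pow_eq_pow_val,
          polyToCone_coord]

end TwistedForms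

/-! ### The grading of the Koszul cycles -/

section KoszulGrading

variable {k : Type u} [Field k] {n p : ℕ} {I : Ideal (Poly k n)}

variable (k n p) in
/-- The homogeneous component of a Koszul form: its values are replaced by their components of
degree `m`. -/
def kosComponent (m : ℤ) : Kos k n (Poly k n) p →ₗ[k] Kos k n (Poly k n) p where
  toFun c := (polyComponent k n m).compAlternatingMap c
  map_add' a b := by ext; simp
  map_smul' r a := by ext; simp

theorem kosComponent_apply (m : ℤ) (c : Kos k n (Poly k n) p) (v : Fin p → ConstVec k n) :
    kosComponent k n p m c v = polyComponent k n m (c v) := rfl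

theorem kosD_kosComponent (m : ℤ) (c : Kos k n (Poly k n) (p + 1)) :
    kosD p (kosComponent k n (p + 1) m c) = kosComponent k n p (m + 1) (kosD p c) := by
  ext1 v
  rw [kosComponent_apply, kosD_apply, kosD_apply, map_sum]
  refine Finset.sum_congr rfl fun i _ => ?_
  rw [kosComponent_apply, smul_eq_mul, smul_eq_mul, mul_comm (MvPolynomial.X i) (c _),
    polyComponent_mul _ (X_mem_polyDegree i), add_sub_cancel_right, mul_comm]

theorem kosD_mem_polyDegree {m : ℤ} {c : Kos k n (Poly k n) (p + 1)}
    (hc : ∀ v, c v ∈ polyDegree k n m) (v : Fin p → ConstVec k n) :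
    kosD p c v ∈ polyDegree k n (m + 1) := by
  rw [kosD_apply]
  refine sum_mem fun i _ => ?_
  rw [add_comm m]
  exact mul_mem_polyDegree (X_mem_polyDegree i) (hc _)

theorem kosComponent_eq_self {m : ℤ} {c : Kos k n (Poly k n) p}
    (hc : ∀ v, c v ∈ polyDegree k n m) : kosComponent k n p m c = c := by
  ext1 v
  rw [kosComponent_apply, polyComponent_eq_self (hc v)]

theorem kosComponent_of_ne {m m' : ℤ} {c : Kos k n (Poly k n) p}
    (hc : ∀ v, c v ∈ polyDegree k n m) (h : m' ≠ m) : kosComponent k n p m' c = 0 := by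
  ext1 v
  rw [kosComponent_apply, polyComponent_of_ne (hc v) h, AlternatingMap.zero_apply]

theorem exists_sum_kosComponent (c : Kos k n (Poly k n) p) :
    ∃ N : ℕ, ∑ m ∈ Finset.range N, kosComponent k n p m c = c := by
  refine ⟨(Finset.univ.sup fun w : Fin p → Fin (n + 1) =>
    (c fun i => unitVec k (w i)).totalDegree) + 1, kos_ext fun w => ?_⟩
  rw [alternatingMap_sum_apply]
  refine sum_polyComponent (Nat.lt_succ_of_le ?_)
  exact Finset.le_sup (f := fun w : Fin p → Fin (n + 1) =>
    (c fun i => unitVec k (w i)).totalDegree) (Finset.mem_univ w)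

theorem kosComponent_mem_kosCycles (hI : ∀ m, ∀ f ∈ I, polyComponent k n m f ∈ I) (m : ℤ)
    {c : Kos k n (Poly k n) p} (hc : c ∈ kosCycles I p) :
    kosComponent k n p m c ∈ kosCycles I p := by
  refine ⟨fun v => hI m _ (hc.1 v), ?_⟩
  cases p with
  | zero => trivial
  | succ p =>
    change kosD p _ = 0
    have h : kosD p c = 0 := hc.2
    have h1 := kosD_kosComponent (m := m) c
    rw [h1, h, map_zero]

theorem kosD_mem_kosCycles {b : Kos k n (Poly k n) (p + 1)} (hb : ∀ v, b v ∈ I) :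
    kosD p b ∈ kosCycles I p := by
  refine ⟨fun v => ?_, ?_⟩
  · rw [kosD_apply]
    exact sum_mem fun i _ => I.mul_mem_left _ (hb _)
  · cases p with
    | zero => trivial
    | succ p => exact kosD_kosD b

/-- There are no nonzero Koszul cycles with constant values in positive degree. -/
theorem eq_zero_of_mem_polyDegree_zero {c : Kos k n (Poly k n) (p + 1)}
    (hc : ∀ v, c v ∈ polyDegree k n 0) (h : kosD p c = 0) : c = 0 := by
  refine kos_ext fun w => ?_
  have hw : (fun i => unitVec k (w i)) =
      Matrix.vecCons (unitVec k (w 0)) fun i => unitVec k (w i.succ) := by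
    funext i
    refine Fin.cases rfl (fun _ => rfl) i
  rw [hw, AlternatingMap.zero_apply]
  have hC : ∀ f ∈ polyDegree k n 0, ∃ a, f = MvPolynomial.C a := fun f hf => by
    refine ⟨_, MvPolynomial.totalDegree_eq_zero_iff_eq_C.1 (Nat.le_zero.1 ?_)⟩
    exact ((mem_polyDegree_natCast (m := 0)).1 hf).totalDegree_le
  choose a ha using fun l => hC _ (hc (Matrix.vecCons (unitVec k l) fun i => unitVec k (w i.succ)))
  have h1 := congrArg (MvPolynomial.coeff (Finsupp.single (w 0) 1)) (DFunLike.congr_fun h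
    fun i => unitVec k (w i.succ))
  rw [kosD_apply, AlternatingMap.zero_apply, MvPolynomial.coeff_sum, MvPolynomial.coeff_zero,
    Finset.sum_eq_single (w 0)] at h1
  · rw [ha, smul_eq_mul, mul_comm, MvPolynomial.coeff_C_mul, MvPolynomial.coeff_X, if_pos rfl,
      mul_one] at h1
    rw [ha, h1, map_zero]
  · intro l _ hl
    rw [ha, smul_eq_mul, mul_comm, MvPolynomial.coeff_C_mul, MvPolynomial.coeff_X,
      if_neg (fun h => hl (Finsupp.single_left_injective one_ne_zero h)), mul_zero]
  · simp

end KoszulGrading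

/-! ### Twisted forms vanishing on a subscheme -/

section VanishingForms

variable {k : Type u} [Field k] {n : ℕ}

variable (k n) in
/-- A polynomial form is determined by its coefficients. -/
def coeffsEquiv (p : ℕ) : Forms k (Poly k n) p ≃ₗ[Poly k n] Kos k n (Poly k n) p :=
  LinearEquiv.ofBijective (coeffs (polyBasis k n) p) ⟨coeffs_injective _ _, coeffs_surjective _ _⟩

theorem coeffsEquiv_apply {p : ℕ} (ω : Forms k (Poly k n) p) :
    coeffsEquiv k n p ω = coeffs (polyBasis k n) p ω := rfl

variable (k n) in
/-- The polynomial form with given coefficients, restricted to the open sets `{xᵢ ≠ 0}`. -/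
def kosToConeForms (p : ℕ) : Kos k n (Poly k n) p →ₗ[Poly k n] ConeForms k n p where
  toFun c := restrictForm p ((coeffsEquiv k n p).symm c)
  map_add' a b := by
    funext i
    simp only [restrictForm, map_add, Pi.add_apply]
  map_smul' f a := by
    funext i
    rw [map_smul, restrictForm, pullback_smul]
    rfl

theorem kosToConeForms_coeffsEquiv {p : ℕ} (ω : Forms k (Poly k n) p) :
    kosToConeForms k n p (coeffsEquiv k n p ω) = restrictForm p ω := by
  change restrictForm p ((coeffsEquiv k n p).symm _) = _
  rw [LinearEquiv.symm_apply_apply]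

theorem kosToConeForms_injective (p : ℕ) : Function.Injective (kosToConeForms k n p) := by
  intro c c' h
  obtain ⟨ω, rfl⟩ := (coeffsEquiv k n p).surjective c
  obtain ⟨ω', rfl⟩ := (coeffsEquiv k n p).surjective c'
  rw [kosToConeForms_coeffsEquiv, kosToConeForms_coeffsEquiv] at h
  ext1 v
  refine polyToCone_injective 0 ?_
  rw [coeffsEquiv_apply, coeffsEquiv_apply, ← coeffs_restrictForm, ← coeffs_restrictForm, h]

variable {Z : Scheme.{u}} (ι : Z ⟶ PSpace k n)

theorem kosToConeForms_mem_twistedForms (hn : 1 ≤ n) {p : ℕ} {r : ℤ} {c : Kos k n (Poly k n) p}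
    (hc : c ∈ kosCycles (satIdeal ι) p) :
    kosToConeForms k n p c ∈ twistedForms ι p r ↔ ∀ v, c v ∈ polyDegree k n (r - p) := by
  rw [mem_twistedForms_iff ι hn]
  constructor
  · rintro ⟨ζ, -, hdeg, h⟩
    rw [← kosToConeForms_coeffsEquiv] at h
    rw [← kosToConeForms_injective p h]
    exact hdeg
  · obtain ⟨ω, rfl⟩ := (coeffsEquiv k n p).surjective c
    exact fun h => ⟨ω, hc, h, (kosToConeForms_coeffsEquiv ω).symm⟩

theorem map_kosCycles (hn : 1 ≤ n) (p : ℕ) :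
    (kosCycles (satIdeal ι) p).map (kosToConeForms k n p) = vanishingForms ι p := by
  refine le_antisymm ?_ (Submodule.span_le.2 (Set.iUnion_subset fun r ω hω => ?_))
  · rintro _ ⟨c, hc, rfl⟩
    obtain ⟨N, hN⟩ := exists_sum_kosComponent c
    rw [← hN, map_sum]
    refine sum_mem fun m _ => Submodule.subset_span (Set.mem_iUnion.2 ⟨m + p, ?_⟩)
    refine (kosToConeForms_mem_twistedForms ι hn
      (kosComponent_mem_kosCycles (polyComponent_mem_satIdeal ι) m hc)).2 fun v => ?_
    rw [add_sub_cancel_right]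
    exact polyComponent_mem _ _
  · obtain ⟨ζ, h, -, rfl⟩ := (mem_twistedForms_iff ι hn).1 hω
    exact ⟨_, h, kosToConeForms_coeffsEquiv ζ⟩

/-- The `R`-module `𝒜^p(Z)` is the module of `p`-cycles of the Koszul complex of `I_Z`. -/
def cyclesEquiv (hn : 1 ≤ n) (p : ℕ) : kosCycles (satIdeal ι) p ≃ₗ[Poly k n] vanishingForms ι p :=
  ((kosCycles (satIdeal ι) p).equivMapOfInjective _ (kosToConeForms_injective p)).trans
    (LinearEquiv.ofEq _ _ (map_kosCycles ι hn p))

theorem cyclesEquiv_mem (hn : 1 ≤ n) {p : ℕ} {d : ℤ} (c : kosCycles (satIdeal ι) p) :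
    cyclesEquiv ι hn p c ∈ vanishingFormsDegree ι p d ↔
      ∀ v, (c : Kos k n (Poly k n) p) v ∈ polyDegree k n (d + 1) := by
  have h : cyclesEquiv ι hn p c ∈ vanishingFormsDegree ι p d ↔
    kosToConeForms k n p c ∈ twistedForms ι p (d + p + 1) := Iff.rfl
  rw [h, kosToConeForms_mem_twistedForms ι hn c.2, show d + p + 1 - p = d + 1 by ring]

theorem isInternal_vanishingFormsDegree (hn : 1 ≤ n) (p : ℕ) :
    DirectSum.IsInternal (vanishingFormsDegree ι p) := by
  refine isInternal_of_projections _
    (((kosCycles (satIdeal ι) p).subtype ∘ₗ (cyclesEquiv ι hn p).symm.toLinearMap).toAddMonoidHom)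
    (Subtype.val_injective.comp (cyclesEquiv ι hn p).symm.injective)
    (fun d => (kosComponent k n p (d + 1)).toAddMonoidHom) (fun d x hx => ?_)
    (fun d e hde x hx => ?_) fun x => ?_
  · obtain ⟨c, rfl⟩ := (cyclesEquiv ι hn p).surjective x
    change kosComponent k n p (d + 1) ((cyclesEquiv ι hn p).symm (cyclesEquiv ι hn p c)) =
      ((cyclesEquiv ι hn p).symm (cyclesEquiv ι hn p c) : kosCycles (satIdeal ι) p)
    rw [LinearEquiv.symm_apply_apply]
    exact kosComponent_eq_self ((cyclesEquiv_mem ι hn c).1 hx)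
  · obtain ⟨c, rfl⟩ := (cyclesEquiv ι hn p).surjective x
    change kosComponent k n p (e + 1) ((cyclesEquiv ι hn p).symm (cyclesEquiv ι hn p c)) = 0
    rw [LinearEquiv.symm_apply_apply]
    exact kosComponent_of_ne ((cyclesEquiv_mem ι hn c).1 hx) (by omega)
  · obtain ⟨c, rfl⟩ := (cyclesEquiv ι hn p).surjective x
    obtain ⟨N, hN⟩ := exists_sum_kosComponent (c : Kos k n (Poly k n) p)
    have hc : c = ∑ m ∈ Finset.range N, ⟨kosComponent k n p m c, kosComponent_mem_kosCycles
        (polyComponent_mem_satIdeal ι) m c.2⟩ := by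
      ext1
      rw [AddSubmonoidClass.coe_finsetSum]
      exact hN.symm
    rw [hc, map_sum]
    refine sum_mem fun m _ => Submodule.mem_iSup_of_mem ((m : ℤ) - 1) ?_
    rw [cyclesEquiv_mem, sub_add_cancel]
    exact fun v => polyComponent_mem _ _

theorem vanishingFormsDegree_eq_bot (hn : 1 ≤ n) {p : ℕ} (hp : 1 ≤ p) {d : ℤ} (hd : d < 0) :
    vanishingFormsDegree ι p d = ⊥ := by
  refine eq_bot_iff.2 fun x hx => ?_
  obtain ⟨c, rfl⟩ := (cyclesEquiv ι hn p).surjective x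
  rw [cyclesEquiv_mem] at hx
  have hc : (c : Kos k n (Poly k n) p) = 0 := by
    obtain ⟨p, rfl⟩ := Nat.exists_eq_add_of_le' hp
    rcases (show d + 1 < 0 ∨ d + 1 = 0 by omega) with h | h
    · ext1 v
      have := hx v
      rwa [polyDegree_of_neg h, Submodule.mem_bot] at this
    · rw [h] at hx
      exact eq_zero_of_mem_polyDegree_zero hx c.2.2
  rw [show c = 0 from Subtype.ext hc, map_zero]
  exact zero_mem _

end VanishingForms

/-! ### The forms `I · ι_rad Ω^{p+1}` as Koszul boundaries -/

section RadialForms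

variable {k : Type u} [Field k] {n : ℕ}

theorem coeffs_iotaRad {p : ℕ} (ω : Forms k (Poly k n) (p + 1)) :
    coeffs (polyBasis k n) p (iotaRad k n p ω) = kosD p (coeffs (polyBasis k n) (p + 1) ω) := by
  ext1 v
  rw [kosD_apply]
  refine (coeffs_contractForms (polyBasis k n) (radial k n) ω v).trans
    (Finset.sum_congr rfl fun l _ => ?_)
  rw [polyBasis_apply, radial, Derivation.liftKaehlerDifferential_comp_D,
    MvPolynomial.mkDerivation_X, smul_eq_mul]

theorem mem_radialForms_iff {I : Ideal (Poly k n)} {p : ℕ} {ω : Forms k (Poly k n) p} :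
    ω ∈ radialForms I p ↔ ∃ b : Kos k n (Poly k n) (p + 1),
      (∀ v, b v ∈ I) ∧ kosD p b = coeffs (polyBasis k n) p ω := by
  constructor
  · intro h
    induction h using Submodule.smul_induction_on' with
    | smul f hf x hx =>
      obtain ⟨ζ, rfl⟩ := hx
      refine ⟨f • coeffs (polyBasis k n) (p + 1) ζ, fun v => I.mul_mem_right _ hf, ?_⟩
      rw [map_smul, map_smul, coeffs_iotaRad]
    | add x _ y _ hx hy =>
      obtain ⟨b, hb, e⟩ := hx
      obtain ⟨b', hb', e'⟩ := hy
      exact ⟨b + b', fun v => I.add_mem (hb v) (hb' v), by rw [map_add, map_add, e, e']⟩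
  · rintro ⟨b, hb, h⟩
    obtain ⟨ζ, rfl⟩ := coeffs_surjective (polyBasis k n) (p + 1) b
    rw [← coeffs_iotaRad] at h
    rw [← coeffs_injective _ _ h, forms_eq_sum ζ, map_sum]
    refine sum_mem fun s _ => ?_
    rw [map_smul]
    exact Submodule.smul_mem_smul (hb _) ⟨_, rfl⟩

theorem coeffs_wedgeD_coord {p : ℕ} (w : Fin p → Fin (n + 1)) (v : Fin p → ConstVec k n) :
    ∃ a : k, coeffs (polyBasis k n) p (wedgeD k fun j => coord (w j)) v = algebraMap k _ a := by
  refine ⟨Matrix.det (Matrix.of fun i j => v j (w i)), ?_⟩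
  rw [coeffs_wedgeD, RingHom.map_det]
  congr 1
  ext1 i j
  rw [Matrix.of_apply, ← polyBasis_apply, dualVec_apply, Finset.sum_eq_single (w i)]
  · simp
  · intro l _ hl
    simp [Finsupp.single_eq_of_ne hl]
  · simp

theorem mem_radialFormsDegree_iff {I : Ideal (Poly k n)} {p : ℕ} {d : ℤ} {ω : radialForms I p} :
    ω ∈ radialFormsDegree I p d ↔ ∃ b : Kos k n (Poly k n) (p + 1),
      (∀ v, b v ∈ I) ∧ (∀ v, b v ∈ polyDegree k n d) ∧
        kosD p b = coeffs (polyBasis k n) p (ω : Forms k (Poly k n) p) := by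
  have hmem : ω ∈ radialFormsDegree I p d ↔ (ω : Forms k (Poly k n) p) ∈
      Submodule.span k {ω | ∃ f ∈ I, f ∈ polyDegree k n d ∧ ∃ v : Fin (p + 1) → Fin (n + 1),
        ω = f • iotaRad k n p (wedgeD k fun j => coord (v j))} := Iff.rfl
  rw [hmem]
  clear hmem
  generalize (ω : Forms k (Poly k n) p) = x
  constructor
  · intro h
    induction h using Submodule.span_induction with
    | mem x hx =>
      obtain ⟨f, hf, hd, w, rfl⟩ := hx
      refine ⟨f • coeffs (polyBasis k n) (p + 1) (wedgeD k fun j => coord (w j)),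
        fun v => I.mul_mem_right _ hf, fun v => ?_, ?_⟩
      · obtain ⟨a, ha⟩ := coeffs_wedgeD_coord w v
        rw [AlternatingMap.smul_apply, ha, smul_eq_mul, mul_comm, ← Algebra.smul_def]
        exact Submodule.smul_mem _ a hd
      · rw [map_smul, map_smul, coeffs_iotaRad]
    | zero => exact ⟨0, fun _ => zero_mem _, fun _ => zero_mem _, by rw [map_zero, map_zero]⟩
    | add x y _ _ hx hy =>
      obtain ⟨b, hb, hd, e⟩ := hx
      obtain ⟨b', hb', hd', e'⟩ := hy
      exact ⟨b + b', fun v => add_mem (hb v) (hb' v), fun v => add_mem (hd v) (hd' v), by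
        rw [map_add, map_add, e, e']⟩
    | smul a x _ hx =>
      obtain ⟨b, hb, hd, e⟩ := hx
      refine ⟨algebraMap k (Poly k n) a • b, fun v => I.mul_mem_left _ (hb v), fun v => ?_, ?_⟩
      · rw [AlternatingMap.smul_apply, algebraMap_smul]
        exact Submodule.smul_mem _ a (hd v)
      · rw [map_smul, e, ← map_smul, algebraMap_smul]
  · rintro ⟨b, hb, hd, h⟩
    obtain ⟨ζ, rfl⟩ := coeffs_surjective (polyBasis k n) (p + 1) b
    rw [← coeffs_iotaRad] at h
    rw [← coeffs_injective _ _ h, forms_eq_sum ζ, map_sum]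
    refine sum_mem fun s _ => ?_
    rw [map_smul]
    exact Submodule.subset_span ⟨_, hb _, hd _, _, rfl⟩

/-- The coefficients of the forms in `I · ι_rad Ω^{p+1}` are Koszul cycles. -/
def radialToCycles (I : Ideal (Poly k n)) (p : ℕ) :
    radialForms I p →ₗ[Poly k n] kosCycles I p :=
  (coeffs (polyBasis k n) p ∘ₗ (radialForms I p).subtype).codRestrict _ fun ω => by
    obtain ⟨b, hb, h⟩ := mem_radialForms_iff.1 ω.2
    change coeffs (polyBasis k n) p (ω : Forms k (Poly k n) p) ∈ _
    rw [← h]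
    exact kosD_mem_kosCycles hb

theorem coe_radialToCycles {I : Ideal (Poly k n)} {p : ℕ} (ω : radialForms I p) :
    (radialToCycles I p ω : Kos k n (Poly k n) p) =
      coeffs (polyBasis k n) p (ω : Forms k (Poly k n) p) := rfl

theorem radialToCycles_injective (I : Ideal (Poly k n)) (p : ℕ) :
    Function.Injective (radialToCycles I p) := fun _ _ h =>
  Subtype.ext (coeffs_injective (polyBasis k n) p (congrArg Subtype.val h))

theorem isInternal_radialFormsDegree {I : Ideal (Poly k n)}
    (hI : ∀ m, ∀ f ∈ I, polyComponent k n m f ∈ I) (p : ℕ) :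
    DirectSum.IsInternal (radialFormsDegree I p) := by
  have hdeg : ∀ d, ∀ ω ∈ radialFormsDegree I p d, ∀ v,
      coeffs (polyBasis k n) p (ω : Forms k (Poly k n) p) v ∈ polyDegree k n (d + 1) :=
    fun d ω hω v => by
      obtain ⟨b, -, hd, h⟩ := mem_radialFormsDegree_iff.1 hω
      rw [← h]
      exact kosD_mem_polyDegree hd v
  refine isInternal_of_projections _
    (((kosCycles I p).subtype ∘ₗ radialToCycles I p).toAddMonoidHom)
    (Subtype.val_injective.comp (radialToCycles_injective I p))
    (fun d => (kosComponent k n p (d + 1)).toAddMonoidHom)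
    (fun d x hx => kosComponent_eq_self (hdeg d x hx))
    (fun d e hde x hx => kosComponent_of_ne (hdeg d x hx) (by omega)) fun x => ?_
  obtain ⟨b, hb, h⟩ := mem_radialForms_iff.1 x.2
  obtain ⟨N, hN⟩ := exists_sum_kosComponent b
  choose y hy using fun m : ℕ => coeffs_surjective (polyBasis k n) p
    (kosD p (kosComponent k n (p + 1) m b))
  have hbm : ∀ (m : ℕ) v, kosComponent k n (p + 1) m b v ∈ I := fun m v => hI m _ (hb v)
  have hx : x = ∑ m ∈ Finset.range N, ⟨y m, mem_radialForms_iff.2 ⟨_, hbm m, (hy m).symm⟩⟩ := by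
    ext1
    rw [AddSubmonoidClass.coe_finsetSum]
    refine coeffs_injective (polyBasis k n) p ?_
    have h1 := congrArg (kosD p) hN
    rw [map_sum] at h1
    rw [map_sum, ← h, ← h1]
    exact Finset.sum_congr rfl fun m _ => (hy m).symm
  rw [hx]
  exact sum_mem fun m _ => Submodule.mem_iSup_of_mem (m : ℤ) (mem_radialFormsDegree_iff.2
    ⟨_, hbm m, fun v => polyComponent_mem _ _, (hy m).symm⟩)

end RadialForms

/-! ### The graded comparison with `Tor` -/

section Comparison

variable {k : Type u} [Field k] {n p : ℕ} {I : Ideal (Poly k n)} {F : GradedFreeResolution I}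

/-- A surjection from the Koszul cycles onto `Tor` which shifts the degree by `p` is surjective in
each degree. -/
theorem exists_mem_polyDegree_of_mem_torDegree (hI : ∀ m, ∀ f ∈ I, polyComponent k n m f ∈ I)
    {β : kosCycles I p →ₗ[Poly k n] F.Tor p} (hβ : Function.Surjective β)
    (hdeg : ∀ (m : ℤ) (c : kosCycles I p),
      (∀ v, (c : Kos k n (Poly k n) p) v ∈ polyDegree k n m) → β c ∈ F.torDegree p (m + p))
    {m : ℤ} {t : F.Tor p} (ht : t ∈ F.torDegree p (m + p)) :
    ∃ c : kosCycles I p, (∀ v, (c : Kos k n (Poly k n) p) v ∈ polyDegree k n m) ∧ β c = t := by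
  obtain ⟨c, rfl⟩ := hβ t
  let comp : ℤ → kosCycles I p → kosCycles I p := fun e c =>
    ⟨kosComponent k n p e c, kosComponent_mem_kosCycles hI e c.2⟩
  have hcomp : ∀ e c v, (comp e c : Kos k n (Poly k n) p) v ∈ polyDegree k n e :=
    fun e c v => polyComponent_mem _ _
  refine ⟨comp m c, hcomp m c, (sub_eq_zero.1 ?_).symm⟩
  have h1 : β c - β (comp m c) ∈ F.torDegree p (m + p) := sub_mem ht (hdeg m _ (hcomp m c))
  -- the difference is also a sum of elements of the other degrees
  have h2 : β c - β (comp m c) ∈ ⨆ j, ⨆ (_ : j ≠ m + p), F.torDegree p j := by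
    obtain ⟨N, hN⟩ := exists_sum_kosComponent (c : Kos k n (Poly k n) p)
    have hc : c = ∑ e ∈ Finset.range N, comp e c := by
      ext1
      rw [AddSubmonoidClass.coe_finsetSum]
      exact hN.symm
    have hcm : comp m c = ∑ e ∈ Finset.range N, comp m (comp e c) := by
      ext1
      rw [AddSubmonoidClass.coe_finsetSum]
      exact (congrArg (kosComponent k n p m) hN.symm).trans (map_sum _ _ _)
    rw [(congrArg β hc).trans (map_sum _ _ _), (congrArg β hcm).trans (map_sum _ _ _),
      ← Finset.sum_sub_distrib]
    refine sum_mem fun e _ => ?_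
    by_cases he : (e : ℤ) = m
    · have : comp m (comp e c) = comp e c := Subtype.ext (kosComponent_eq_self (he ▸ hcomp e c))
      rw [this, sub_self]
      exact zero_mem _
    · have : comp m (comp e c) = 0 := Subtype.ext (kosComponent_of_ne (hcomp e c) (Ne.symm he))
      rw [this, map_zero, sub_zero]
      refine Submodule.mem_iSup_of_mem ((e : ℤ) + p) (Submodule.mem_iSup_of_mem ?_ ?_)
      · exact fun h => he (add_right_cancel h)
      · exact hdeg _ _ (hcomp e c)
  exact (Submodule.disjoint_def.1 ((iSupIndep_def.1
    (F.isInternal_torDegree p).submodule_iSupIndep) (m + p))) _ h1 h2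

end Comparison

end SyzForms

end

open SyzForms in
theorem theoremA {k : Type u} [Field k] {n : ℕ} (hn : 1 ≤ n)
    {Z : AlgebraicGeometry.Scheme.{u}} (ι : Z ⟶ PSpace k n)
    [AlgebraicGeometry.IsClosedImmersion ι] (p : ℕ) :
    DirectSum.IsInternal (vanishingFormsDegree ι p) ∧
    (1 ≤ p → ∀ d : ℤ, d < 0 → vanishingFormsDegree ι p d = ⊥) ∧
    DirectSum.IsInternal (radialFormsDegree (satIdeal ι) p) ∧
    Nonempty (GradedFreeResolution (satIdeal ι)) ∧
    ∀ F : GradedFreeResolution (satIdeal ι),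
      DirectSum.IsInternal (F.torDegree p) ∧
      ∃ (α : radialForms (satIdeal ι) p →ₗ[Poly k n] vanishingForms ι p)
        (β : vanishingForms ι p →ₗ[Poly k n] F.Tor p),
        (∀ ω, (α ω : ConeForms k n p) = restrictForm p ω) ∧
        Function.Injective α ∧ Function.Exact α β ∧ Function.Surjective β ∧
        (∀ d, Set.MapsTo α (radialFormsDegree (satIdeal ι) p d) (vanishingFormsDegree ι p d)) ∧
        (∀ d, Set.MapsTo β (vanishingFormsDegree ι p d) (F.torDegree p (d + p + 1))) ∧
        ∀ d, (∀ f ∈ satIdeal ι, f ∈ polyDegree k n d → f = 0) →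
          Set.BijOn β (vanishingFormsDegree ι p d) (F.torDegree p (d + p + 1)) := by
  refine ⟨isInternal_vanishingFormsDegree ι hn p,
    fun hp d hd => vanishingFormsDegree_eq_bot ι hn hp hd,
    isInternal_radialFormsDegree (polyComponent_mem_satIdeal ι) p,
    nonempty_gradedFreeResolution _ (polyComponent_mem_satIdeal ι),
    fun F => ⟨F.isInternal_torDegree p, ?_⟩⟩
  obtain ⟨β, hsurj, hker, hdeg⟩ := F.exists_cycles_to_tor p
  let e := cyclesEquiv ι hn p
  have hβe : ∀ c, (β ∘ₗ e.symm.toLinearMap) (e c) = β c := fun c =>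
    congrArg β (e.symm_apply_apply c)
  have hmaps : ∀ d, Set.MapsTo (β ∘ₗ e.symm.toLinearMap) (vanishingFormsDegree ι p d)
      (F.torDegree p (d + p + 1)) := fun d x hx => by
    obtain ⟨c, rfl⟩ := e.surjective x
    have h := hdeg (d + 1) c ((cyclesEquiv_mem ι hn c).1 hx)
    rw [show d + 1 + (p : ℤ) = d + p + 1 by ring] at h
    rw [hβe]
    exact h
  refine ⟨e.toLinearMap ∘ₗ radialToCycles _ p, β ∘ₗ e.symm.toLinearMap, fun ω => ?_,
    e.injective.comp (radialToCycles_injective _ p), fun x => ?_, hsurj.comp e.symm.surjective,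
    fun d ω hω => ?_, hmaps, fun d hd => ⟨hmaps d, ?_, fun t ht => ?_⟩⟩
  · exact kosToConeForms_coeffsEquiv (ω : Forms k (Poly k n) p)
  · obtain ⟨c, rfl⟩ := e.surjective x
    rw [hβe, hker]
    constructor
    · rintro ⟨b, hb, h⟩
      obtain ⟨ω, hω⟩ := coeffs_surjective (polyBasis k n) p (c : Kos k n (Poly k n) p)
      exact ⟨⟨ω, mem_radialForms_iff.2 ⟨b, hb, h.trans hω.symm⟩⟩, congrArg e (Subtype.ext hω)⟩
    · rintro ⟨ω, hω⟩
      obtain ⟨b, hb, h⟩ := mem_radialForms_iff.1 ω.2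
      exact ⟨b, hb, h.trans (congrArg Subtype.val (e.injective hω))⟩
  · obtain ⟨b, -, hb, h⟩ := mem_radialFormsDegree_iff.1 hω
    refine (cyclesEquiv_mem ι hn _).2 fun v => ?_
    rw [coe_radialToCycles, ← h]
    exact kosD_mem_polyDegree hb v
  -- the kernel consists of boundaries of Koszul forms with values in `I_d = 0`
  · intro x hx y hy hxy
    obtain ⟨c, hc⟩ := e.surjective (x - y)
    have hmem : e c ∈ vanishingFormsDegree ι p d := hc ▸ sub_mem hx hy
    have h0 : β c = 0 := by
      rw [← hβe, hc, map_sub, hxy, sub_self]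
    obtain ⟨b, hb, h⟩ := (hker c).1 h0
    have hbd : kosComponent k n (p + 1) d b = 0 := by
      ext1 v
      exact hd _ (polyComponent_mem_satIdeal ι d _ (hb v)) (polyComponent_mem _ _)
    have h1 := kosD_kosComponent d b
    rw [hbd, map_zero, h, kosComponent_eq_self ((cyclesEquiv_mem ι hn c).1 hmem)] at h1
    rw [← sub_eq_zero, ← hc, show c = 0 from Subtype.ext h1.symm, map_zero]
  · rw [SetLike.mem_coe, show d + (p : ℤ) + 1 = d + 1 + p by ring] at ht
    obtain ⟨c, hc, rfl⟩ := exists_mem_polyDegree_of_mem_torDegree (polyComponent_mem_satIdeal ι)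
      hsurj hdeg ht
    exact ⟨e c, (cyclesEquiv_mem ι hn c).2 hc, hβe c⟩
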